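/- Let $\Pi=\{z\in\mathbb C:\operatorname{Im}z>0\}$, and let $\mathcal O(\Pi)$, $\mathcal O(\Pi\times\Pi)$ be the spaces of holomorphic functions with the topology of locally uniform convergence. Let $\widetilde{SL}(2,\mathbb R)$ be the universal covering group of $SL(2,\mathbb R)$, realized as the group of pairs $(g,\varphi)$ with $g=\begin{pmatrix}a&b\\c&d\end{pmatrix}\in SL(2,\mathbb R)$ and $\varphi\in\mathcal O(\Pi)$, $e^{\varphi(z)}=cz+d$, with product $(g_1,\varphi_1)(g_2,\varphi_2)=(g_1g_2,\ \varphi_1(g_2\cdot z)+\varphi_2(z))$. For $\lambda\in\mathbb C$ it acts on $\mathcal O(\Pi)$ by $$(\pi_\lambda(\tilde g)f)(z)=(cz+d)^{-\lambda}f\Big(\frac{az+b}{cz+d}\Big),\qquad (cz+d)^{-\lambda}:=e^{-\lambda\varphi(z)},\qquad \tilde g^{-1}=\Big(\begin{pmatrix}a&b\\c&d\end{pmatrix},\varphi\Big),$$ and $\pi_{\lambda'}\widehat\otimes\pi_{\lambda''}$ denotes the tensor product representation on $\mathcal O(\Pi\times\Pi)$, $$f(z_1,z_2)\mapsto (cz_1+d)^{-\lambda'}(cz_2+d)^{-\lambda''}f\Big(\frac{az_1+b}{cz_1+d},\frac{az_2+b}{cz_2+d}\Big).$$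 Suppose $\lambda',\lambda'',\lambda'''\in\mathbb C$ satisfy $\ell:=\frac12(\lambda'''-\lambda'-\lambda'')\in\mathbb N=\{0,1,2,\dots\}$, $\operatorname{Re}(\lambda'+\ell)>0$ and $\operatorname{Re}(\lambda''+\ell)>0$. For $g\in\mathcal O(\Pi)$ put $$(\Psi_{\lambda',\lambda''}^{\lambda'''}g)(\zeta_1,\zeta_2)=\frac{(\zeta_1-\zeta_2)^\ell}{2^{\lambda'+\lambda''+2\ell-1}\,\ell!}\int_{-1}^1 g\Big(\frac{(\zeta_2-\zeta_1)v+(\zeta_1+\zeta_2)}2\Big)(1-v)^{\lambda'+\ell-1}(1+v)^{\lambda''+\ell-1}\,dv .$$ (1) The integral converges absolutely, $\Psi_{\lambda',\lambda''}^{\lambda'''}$ is a continuous linear map $\mathcal O(\Pi)\to\mathcal O(\Pi\times\Pi)$, and it intertwines $\pi_{\lambda'''}$ with $\pi_{\lambda'}\widehat\otimes\pi_{\lambda''}$: for every $\tilde g\in\widetilde{SL}(2,\mathbb R)$, $$\Psi_{\lambda',\lambda''}^{\lambda'''}\circ\pi_{\lambda'''}(\tilde g)=(\pi_{\lambda'}\widehat\otimes\pi_{\lambda''})(\tilde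 g)\circ\Psi_{\lambda',\lambda''}^{\lambda'''}.$$ (2) If moreover $\lambda'$ and $\lambda''$ are real and greater than $1$, then there is a constant $r>0$ such that $r\,\Psi_{\lambda',\lambda''}^{\lambda'''}$ restricts to a linear isometric embedding $$\mathcal H^2(\Pi)_{\lambda'''}\longrightarrow\mathcal H^2(\Pi\times\Pi)_{(\lambda',\lambda'')}$$ of weighted Bergman spaces, where $\mathcal H^2(\Pi)_\lambda=(\mathcal O\cap L^2)(\Pi,\,y^{\lambda-2}dx\,dy)$ and $\mathcal H^2(\Pi\times\Pi)_{(\lambda',\lambda'')}=(\mathcal O\cap L^2)(\Pi\times\Pi,\ y_1^{\lambda'-2}y_2^{\lambda''-2}dx_1dy_1dx_2dy_2)$. -/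

import Mathlib

open MeasureTheory UpperHalfPlane
open scoped Manifold MatrixGroups

noncomputable section

namespace Holographic

/-! ### The universal covering group of `SL(2, ℝ)` -/

/-- The universal covering group of `SL(2, ℝ)`, in its standard realization: pairs `(g, φ)` where
`g ∈ SL(2, ℝ)` has lower row `(c, d)` and `φ` is a holomorphic function on the upper half plane
with `exp (φ z) = c z + d`, i.e. a holomorphic branch of `log (c z + d)`. -/
@[ext]
structure SL2Tilde where
  g : SL(2, ℝ)
  φ : ℍ → ℂ
  holo : MDifferentiable 𝓘(ℂ) 𝓘(ℂ) φ
  exp_φ : ∀ z : ℍ, Complex.exp (φ z) = ((g 1 0 : ℝ) : ℂ) * z + ((g 1 1 : ℝ) : ℂ)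

theorem mdifferentiable_sl_smul (g : SL(2, ℝ)) :
    MDifferentiable 𝓘(ℂ) 𝓘(ℂ) (fun z : ℍ => g • z) :=
  UpperHalfPlane.mdifferentiable_smul (g := (g : GL (Fin 2) ℝ)) (by simp)

theorem sl_cocycle (g h : SL(2, ℝ)) (z : ℍ) :
    (((g * h) 1 0 : ℝ) : ℂ) * z + (((g * h) 1 1 : ℝ) : ℂ) =
      (((g 1 0 : ℝ) : ℂ) * (h • z : ℍ) + ((g 1 1 : ℝ) : ℂ)) *
        (((h 1 0 : ℝ) : ℂ) * z + ((h 1 1 : ℝ) : ℂ)) := by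
  have h0 : ((h 1 0 : ℝ) : ℂ) * z + ((h 1 1 : ℝ) : ℂ) ≠ 0 :=
    UpperHalfPlane.denom_ne_zero (h : GL (Fin 2) ℝ) z
  have h1 : ((h • z : ℍ) : ℂ) = (((h 0 0 : ℝ) : ℂ) * z + ((h 0 1 : ℝ) : ℂ)) /
      (((h 1 0 : ℝ) : ℂ) * z + ((h 1 1 : ℝ) : ℂ)) :=
    UpperHalfPlane.coe_specialLinearGroup_apply h z
  rw [h1]
  simp only [Matrix.SpecialLinearGroup.coe_mul, Matrix.mul_apply, Fin.sum_univ_two]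
  push_cast
  field_simp
  ring

namespace SL2Tilde

/-- `(g₁, φ₁) (g₂, φ₂) = (g₁ g₂, φ₁ ∘ g₂ + φ₂)`. -/
instance : Mul SL2Tilde where
  mul a b :=
    { g := a.g * b.g
      φ := fun z => a.φ (b.g • z) + b.φ z
      holo := (a.holo.comp (mdifferentiable_sl_smul b.g)).add b.holo
      exp_φ := fun z => by
        rw [Complex.exp_add, a.exp_φ, b.exp_φ, sl_cocycle] }

instance : One SL2Tilde where
  one :=
    { g := 1
      φ := fun _ => 0
      holo := mdifferentiable_const
      exp_φ := fun z => by simp }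

instance : Inv SL2Tilde where
  inv a :=
    { g := a.g⁻¹
      φ := fun z => - a.φ (a.g⁻¹ • z)
      holo := (a.holo.comp (mdifferentiable_sl_smul a.g⁻¹)).neg
      exp_φ := fun z => by
        have h := sl_cocycle a.g a.g⁻¹ z
        rw [mul_inv_cancel, ← a.exp_φ] at h
        have h1 : (((1 : SL(2, ℝ)) 1 0 : ℝ) : ℂ) * z + (((1 : SL(2, ℝ)) 1 1 : ℝ) : ℂ) = 1 := by
          simp
        rw [h1] at h
        rw [Complex.exp_neg]
        exact inv_eq_of_mul_eq_one_right h.symm }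

@[simp] theorem mul_g (a b : SL2Tilde) : (a * b).g = a.g * b.g := rfl
@[simp] theorem mul_φ (a b : SL2Tilde) (z : ℍ) : (a * b).φ z = a.φ (b.g • z) + b.φ z := rfl
@[simp] theorem one_g : (1 : SL2Tilde).g = 1 := rfl
@[simp] theorem one_φ (z : ℍ) : (1 : SL2Tilde).φ z = 0 := rfl
@[simp] theorem inv_g (a : SL2Tilde) : a⁻¹.g = a.g⁻¹ := rfl
@[simp] theorem inv_φ (a : SL2Tilde) (z : ℍ) : a⁻¹.φ z = - a.φ (a.g⁻¹ • z) := rfl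

instance : Group SL2Tilde :=
  Group.ofLeftAxioms
    (fun a b c => by
      ext z
      · simp [mul_assoc]
      · simp [mul_smul, add_assoc])
    (fun a => by
      ext z
      · simp
      · simp)
    (fun a => by
      ext z
      · simp
      · simp)

/-- The covering homomorphism onto `SL(2, ℝ)`. -/
def proj : SL2Tilde →* SL(2, ℝ) where
  toFun := SL2Tilde.g
  map_one' := rfl
  map_mul' _ _ := rfl

theorem proj_surjective : Function.Surjective proj := by
  intro g
  have hne : ∀ z : ℍ, ((g 1 0 : ℝ) : ℂ) * z + ((g 1 1 : ℝ) : ℂ) ≠ 0 := fun z =>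
    UpperHalfPlane.denom_ne_zero (g : GL (Fin 2) ℝ) z
  have hd : ∀ z : ℍ, MDifferentiableAt 𝓘(ℂ) 𝓘(ℂ)
      (fun z : ℍ => ((g 1 0 : ℝ) : ℂ) * z + ((g 1 1 : ℝ) : ℂ)) z := fun z =>
    UpperHalfPlane.mdifferentiable_denom (g : GL (Fin 2) ℝ) z
  refine ⟨⟨g, fun z => Complex.log (((g 1 0 : ℝ) : ℂ) * z + ((g 1 1 : ℝ) : ℂ)), ?_,
    fun z => Complex.exp_log (hne z)⟩, rfl⟩
  by_cases hc : g 1 0 = 0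
  · simp only [hc, Complex.ofReal_zero, zero_mul, zero_add]
    exact mdifferentiable_const
  · intro z
    have hs : ((g 1 0 : ℝ) : ℂ) * z + ((g 1 1 : ℝ) : ℂ) ∈ Complex.slitPlane := by
      right
      simpa using ⟨hc, z.im_pos.ne'⟩
    exact (Complex.differentiableAt_log hs).mdifferentiableAt.comp z (hd z)

/-- The kernel of the covering homomorphism is infinite cyclic: it consists of the pairs
`(1, 2 π i n)` with `n` an integer. -/
theorem proj_eq_one_iff (a : SL2Tilde) :
    proj a = 1 ↔ a.g = 1 ∧ ∃ n : ℤ, ∀ z, a.φ z = n * (2 * Real.pi * Complex.I) := by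
  refine ⟨fun h => ?_, fun h => h.1⟩
  have hg : a.g = 1 := h
  refine ⟨hg, ?_⟩
  have he : ∀ z, Complex.exp (a.φ z) = 1 := fun z => by rw [a.exp_φ, hg]; simp
  choose n hn using fun z => Complex.exp_eq_one_iff.1 (he z)
  have hcont : Continuous (fun z : ℍ => ((n z : ℤ) : ℝ)) := by
    have : (fun z : ℍ => ((n z : ℤ) : ℝ)) = fun z => (a.φ z / (2 * Real.pi * Complex.I)).re := by
      ext z
      rw [hn z, mul_div_assoc, div_self Complex.two_pi_I_ne_zero]
      simp
    rw [this]
    exact Complex.continuous_re.comp (a.holo.continuous.div_const _)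
  have hn' : Continuous n := Int.isClosedEmbedding_coe_real.isEmbedding.continuous_iff.2 hcont
  refine ⟨n UpperHalfPlane.I, fun z => ?_⟩
  rw [hn z, PreconnectedSpace.constant inferInstance hn' (x := z) (y := UpperHalfPlane.I)]

end SL2Tilde

/-! ### Holomorphic functions and the representations `π_l` -/

/-- The space `O(M)` of holomorphic functions on a complex manifold `M`, with the topology of
locally uniform convergence (the compact-open topology inherited from `C(M, ℂ)`). -/
def Hol {E H : Type*} [NormedAddCommGroup E] [NormedSpace ℂ E] [TopologicalSpace H]
    (I : ModelWithCorners ℂ E H) (M : Type*) [TopologicalSpace M] [ChartedSpace H M] :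
    Submodule ℂ C(M, ℂ) where
  carrier := {f | MDifferentiable I 𝓘(ℂ) f}
  add_mem' hf hg := MDifferentiable.add hf hg
  zero_mem' := mdifferentiable_const
  smul_mem' c _ hf := MDifferentiable.const_smul c hf

/-- `O(Π)`, where `Π` is the upper half plane. -/
abbrev HolPi : Submodule ℂ C(ℍ, ℂ) := Hol 𝓘(ℂ) ℍ

/-- `O(Π × Π)`. -/
abbrev HolPi2 : Submodule ℂ C(ℍ × ℍ, ℂ) := Hol (𝓘(ℂ).prod 𝓘(ℂ)) (ℍ × ℍ)

/-- The factor `(c z + d) ^ (-l)` attached to an element of the covering group lying over a matrix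
with lower row `(c, d)`. -/
def autFactor (l : ℂ) (a : SL2Tilde) (z : ℍ) : ℂ := Complex.exp (-l * a.φ z)

theorem mdifferentiable_autFactor (l : ℂ) (a : SL2Tilde) :
    MDifferentiable 𝓘(ℂ) 𝓘(ℂ) (autFactor l a) := by
  have h : Differentiable ℂ (fun w : ℂ => Complex.exp (-l * w)) := by fun_prop
  exact h.mdifferentiable.comp a.holo

theorem autFactor_mul (l : ℂ) (a b : SL2Tilde) (z : ℍ) :
    autFactor l (a * b) z = autFactor l a (b.g • z) * autFactor l b z := by
  simp [autFactor, ← Complex.exp_add, mul_add]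

/-- The representation `π_l` of the universal covering group of `SL(2, ℝ)` on `O(Π)`:
`(π_l(a) f)(z) = (c z + d) ^ (-l) f ((α z + β) / (c z + d))`, where `a⁻¹` lies over the matrix
`(α β; c d)`. -/
def piRep (l : ℂ) : Representation ℂ SL2Tilde HolPi where
  toFun a :=
    { toFun := fun f =>
        have h : MDifferentiable 𝓘(ℂ) 𝓘(ℂ)
            (fun z : ℍ => autFactor l a⁻¹ z * f.1 (a⁻¹.g • z)) :=
          (mdifferentiable_autFactor l a⁻¹).mul (f.2.comp (mdifferentiable_sl_smul a⁻¹.g))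
        ⟨⟨fun z => autFactor l a⁻¹ z * f.1 (a⁻¹.g • z), h.continuous⟩, h⟩
      map_add' := fun f₁ f₂ => by
        ext z
        simp [mul_add]
      map_smul' := fun c f => by
        ext z
        simp
        ring }
  map_one' := by
    ext f z
    simp [autFactor]
  map_mul' a b := by
    ext f z
    simp only [mul_inv_rev, autFactor_mul]
    simp [mul_smul]
    ring

/-- The outer tensor product of `π_l₁` and `π_l₂`: the representation of the direct product of two
copies of the covering group on `O(Π × Π)`, the completed tensor product of `O(Π)` with itself. -/
def outerRep (l₁ l₂ : ℂ) : Representation ℂ (SL2Tilde × SL2Tilde) HolPi2 where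
  toFun a :=
    { toFun := fun f =>
        have h : MDifferentiable (𝓘(ℂ).prod 𝓘(ℂ)) 𝓘(ℂ)
            (fun z : ℍ × ℍ => autFactor l₁ a.1⁻¹ z.1 * autFactor l₂ a.2⁻¹ z.2 *
              f.1 (a.1⁻¹.g • z.1, a.2⁻¹.g • z.2)) :=
          (((mdifferentiable_autFactor l₁ a.1⁻¹).comp mdifferentiable_fst).mul
            ((mdifferentiable_autFactor l₂ a.2⁻¹).comp mdifferentiable_snd)).mul
            (f.2.comp (((mdifferentiable_sl_smul a.1⁻¹.g).comp mdifferentiable_fst).prodMk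
              ((mdifferentiable_sl_smul a.2⁻¹.g).comp mdifferentiable_snd)))
        ⟨⟨fun z => autFactor l₁ a.1⁻¹ z.1 * autFactor l₂ a.2⁻¹ z.2 *
              f.1 (a.1⁻¹.g • z.1, a.2⁻¹.g • z.2), h.continuous⟩, h⟩
      map_add' := fun f₁ f₂ => by
        ext z
        simp [mul_add]
      map_smul' := fun c f => by
        ext z
        simp
        ring }
  map_one' := by
    ext f z
    simp [autFactor]
  map_mul' a b := by
    ext f z
    simp only [Prod.fst_mul, Prod.snd_mul, mul_inv_rev, autFactor_mul]
    simp [mul_smul]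
    ring

/-- The tensor product representation of `π_l₁` and `π_l₂` on `O(Π × Π)`: the outer tensor product
restricted to the diagonal. -/
def tensorRep (l₁ l₂ : ℂ) : Representation ℂ SL2Tilde HolPi2 :=
  (outerRep l₁ l₂).comp ((MonoidHom.id SL2Tilde).prod (MonoidHom.id SL2Tilde))

/-! ### The line integral -/

/-- The point `((ζ₂ - ζ₁) v + (ζ₁ + ζ₂)) / 2` of the segment joining `ζ₁` and `ζ₂`. For
`-1 ≤ v ≤ 1` it lies in the upper half plane; other values of `v` are never used. -/
def segPt (ζ₁ ζ₂ : ℍ) (v : ℝ) : ℍ :=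
  ofComplex ((((ζ₂ : ℂ) - ζ₁) * v + (ζ₁ + ζ₂)) / 2)

/-- The integrand `g(t(v)) (1 - v) ^ (l₁ + ℓ - 1) (1 + v) ^ (l₂ + ℓ - 1)`. -/
def psiIntegrand (l₁ l₂ : ℂ) (ℓ : ℕ) (g : ℍ → ℂ) (ζ₁ ζ₂ : ℍ) (v : ℝ) : ℂ :=
  g (segPt ζ₁ ζ₂ v) * ((1 - v : ℝ) : ℂ) ^ (l₁ + ℓ - 1) * ((1 + v : ℝ) : ℂ) ^ (l₂ + ℓ - 1)

/-- The line integral `(Ψ g)(ζ₁, ζ₂)`. -/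
def psiIntegral (l₁ l₂ : ℂ) (ℓ : ℕ) (g : ℍ → ℂ) (ζ₁ ζ₂ : ℍ) : ℂ :=
  ((ζ₁ : ℂ) - ζ₂) ^ ℓ / ((2 : ℂ) ^ (l₁ + l₂ + 2 * ℓ - 1) * (ℓ.factorial : ℂ)) *
    ∫ v in (-1 : ℝ)..1, psiIntegrand l₁ l₂ ℓ g ζ₁ ζ₂ v

/-! ### Weighted Bergman spaces -/

/-- The measure `y ^ (l - 2) dx dy` on the upper half plane. -/
def bergmanMeasure (l : ℝ) : Measure ℍ :=
  ((volume : Measure ℂ).comap UpperHalfPlane.coe).withDensity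
    (fun z => ENNReal.ofReal (z.im ^ (l - 2)))

/-- The square integrable holomorphic functions on a complex manifold with a measure `μ`, as a
subspace of the Hilbert space `L²(μ)`, with the induced norm and inner product. -/
def bergman {E H : Type*} [NormedAddCommGroup E] [NormedSpace ℂ E] [TopologicalSpace H]
    (I : ModelWithCorners ℂ E H) {M : Type*} [TopologicalSpace M] [ChartedSpace H M]
    [MeasurableSpace M] (μ : Measure M) : Submodule ℂ (Lp ℂ 2 μ) where
  carrier := {F | ∃ f : Hol I M, F =ᵐ[μ] f.1}
  add_mem' := by
    rintro F G ⟨f, hf⟩ ⟨g, hg⟩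
    exact ⟨f + g, (Lp.coeFn_add F G).trans (hf.add hg)⟩
  zero_mem' := ⟨0, Lp.coeFn_zero ℂ 2 μ⟩
  smul_mem' := by
    rintro c F ⟨f, hf⟩
    exact ⟨c • f, (Lp.coeFn_smul c F).trans (hf.const_smul c)⟩

/-- The weighted Bergman space `H²(Π)_l = (O ∩ L²)(Π, y ^ (l - 2) dx dy)`. -/
abbrev BergmanPi (l : ℝ) : Submodule ℂ (Lp ℂ 2 (bergmanMeasure l)) :=
  bergman 𝓘(ℂ) (bergmanMeasure l)

/-- The weighted Bergman space `H²(Π × Π)_(l₁, l₂)`, for the measure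
`y₁ ^ (l₁ - 2) y₂ ^ (l₂ - 2) dx₁ dy₁ dx₂ dy₂`. -/
abbrev BergmanPi2 (l₁ l₂ : ℝ) :
    Submodule ℂ (Lp ℂ 2 ((bergmanMeasure l₁).prod (bergmanMeasure l₂))) :=
  bergman (𝓘(ℂ).prod 𝓘(ℂ)) ((bergmanMeasure l₁).prod (bergmanMeasure l₂))

end Holographic

end

open MeasureTheory UpperHalfPlane
open scoped Manifold MatrixGroups

noncomputable section

open Set Filter Topology
open scoped ComplexConjugate

namespace Holographic

/-! ### Segments in the upper half plane -/

/-! Convergence, holomorphy and continuity are soft: the weight is a shifted Beta density,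
integrable under the two real part conditions, and the other factor is controlled on compact
segments.

Equivariance is proved on a thin set and continued. If `c p + d` is a positive real multiple of `c q
+ d`, the fractional linear map `h` sends the segment from `p` to `q` onto the segment from `h p` to
`h q`; the parameter undergoes the real substitution `segSubst`, whose effect on the weight produces
exactly the powers of `c z + d` required (`segIntegral_comp_of_real_ratio`). For fixed `q` these `p`
accumulate at `q`, and both sides are holomorphic in `p`, so the identity theorem gives all pairs
(`segIntegral_comp`). The factor `(ζ₁ - ζ₂) ^ ℓ` transforms by the determinant identity
(`psiCLM_piRep`).

The isometry comes from reproducing kernels. Write `k_w(z) = (-i (z - conj w)) ^ (-s)`. The Cayley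
transform and the mean value property on the disc show that, for `s = l > 1`, pairing with `k_w` is
evaluation at `w` up to a positive constant (`integral_mul_conj_bergKer`). The transformation rule,
applied to a constant map, shows that the operator sends the kernel of weight `p + q + 2 ℓ` to a
multiple of `(z₁ - z₂) ^ ℓ` times kernels of exponents `p + ℓ`, `q + ℓ` (`psiCLM_kerHol`). A
binomial expansion shows that the Gram matrix of these images is a positive multiple of that of the
original kernels (`exists_pos_integral_pairKer`); its value is never needed. Hence norms scale by
one constant on the span of kernels. That span is dense (`exists_kerLpSum_tendsto`), and norm
convergence forces locally uniform convergence (`tendsto_kerHolSum`), so continuity of the operator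
identifies the extended isometry with it (`exists_norm_eq`). -/

theorem segPt_im_pos (a b : ℍ) {v : ℝ} (hv : v ∈ Icc (-1 : ℝ) 1) :
    0 < ((((b : ℂ) - a) * v + (a + b)) / 2).im := by
  have h : ((((b : ℂ) - a) * v + (a + b)) / 2) =
      (((1 - v) / 2 : ℝ) : ℂ) * a + (((1 + v) / 2 : ℝ) : ℂ) * b := by
    push_cast; ring
  rw [h]
  simp only [Complex.add_im, Complex.im_ofReal_mul, coe_im]
  have ha := a.im_pos
  have hb := b.im_pos
  rcases le_or_gt v 0 with h0 | h0
  · have : 0 ≤ (1 + v) / 2 * b.im := mul_nonneg (by linarith [hv.1]) hb.le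
    have : 0 < (1 - v) / 2 * a.im := mul_pos (by linarith) ha
    linarith
  · have : 0 < (1 + v) / 2 * b.im := mul_pos (by linarith) hb
    have : 0 ≤ (1 - v) / 2 * a.im := mul_nonneg (by linarith [hv.2]) ha.le
    linarith

theorem coe_segPt (a b : ℍ) {v : ℝ} (hv : v ∈ Icc (-1 : ℝ) 1) :
    (segPt a b v : ℂ) = (((b : ℂ) - a) * v + (a + b)) / 2 := by
  rw [segPt, ofComplex_apply_of_im_pos (segPt_im_pos a b hv)]

theorem continuous_segPt {X : Type*} [TopologicalSpace X] {a b : X → ℍ} {v : X → ℝ}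
    (ha : Continuous a) (hb : Continuous b) (hv : Continuous v)
    (hmem : ∀ x, v x ∈ Icc (-1 : ℝ) 1) : Continuous fun x => segPt (a x) (b x) (v x) := by
  rw [isEmbedding_coe.continuous_iff]
  have h : (UpperHalfPlane.coe ∘ fun x => segPt (a x) (b x) (v x)) =
      fun x => (((b x : ℂ) - a x) * (v x : ℝ) + (a x + b x)) / 2 :=
    funext fun x => coe_segPt _ _ (hmem x)
  rw [h]
  fun_prop

theorem continuousOn_segPt (a b : ℍ) : ContinuousOn (segPt a b) (Icc (-1) 1) := by
  rw [isEmbedding_coe.isInducing.continuousOn_iff]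
  have h : Continuous fun v : ℝ => (((b : ℂ) - a) * v + (a + b)) / 2 := by fun_prop
  exact h.continuousOn.congr fun v hv => coe_segPt a b hv

/-! ### The weight -/

/-- The weight `(1 - v) ^ (α - 1) (1 + v) ^ (β - 1)`. -/
def betaWeight (α β : ℂ) (v : ℝ) : ℂ :=
  ((1 - v : ℝ) : ℂ) ^ (α - 1) * ((1 + v : ℝ) : ℂ) ^ (β - 1)

theorem psiIntegrand_eq (l₁ l₂ : ℂ) (ℓ : ℕ) (g : ℍ → ℂ) (a b : ℍ) :
    psiIntegrand l₁ l₂ ℓ g a b = fun v => g (segPt a b v) * betaWeight (l₁ + ℓ) (l₂ + ℓ) v := by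
  ext v
  rw [psiIntegrand, betaWeight, mul_assoc]

theorem intervalIntegrable_betaWeight {α β : ℂ} (hα : 0 < α.re) (hβ : 0 < β.re) :
    IntervalIntegrable (betaWeight α β) volume (-1) 1 := by
  -- The substitution is `x = (1 + v) / 2`; `β` comes first because `x` corresponds to `1 + v`.
  have h := ((Complex.betaIntegral_convergent hβ hα).comp_mul_left (c := 1 / 2)).comp_add_right 1
  norm_num at h
  refine (h.const_mul ((2 : ℂ) ^ (α - 1) * 2 ^ (β - 1))).congr ?_
  rw [uIoc_of_le (by norm_num)]
  intro v hv
  have h1 : (((1 - v : ℝ)) : ℂ) = ((2 : ℝ) : ℂ) * (((1 - v) / 2 : ℝ) : ℂ) := by push_cast; ring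
  have h2 : (((1 + v : ℝ)) : ℂ) = ((2 : ℝ) : ℂ) * (((1 + v) / 2 : ℝ) : ℂ) := by push_cast; ring
  simp only [betaWeight]
  rw [h1, h2, Complex.mul_cpow_ofReal_nonneg (by norm_num) (by linarith [hv.2]),
    Complex.mul_cpow_ofReal_nonneg (by norm_num) (by linarith [hv.1])]
  have e1 : (1 : ℂ) / 2 * (v + 1) = (((1 + v) / 2 : ℝ) : ℂ) := by push_cast; ring
  have e2 : (1 : ℂ) - (((1 + v) / 2 : ℝ) : ℂ) = (((1 - v) / 2 : ℝ) : ℂ) := by push_cast; ring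
  simp only [e1, e2, Complex.ofReal_ofNat]
  ring

theorem intervalIntegrable_comp_segPt_mul {α β : ℂ} (hα : 0 < α.re) (hβ : 0 < β.re) {g : ℍ → ℂ}
    (hg : Continuous g) (a b : ℍ) :
    IntervalIntegrable (fun v => g (segPt a b v) * betaWeight α β v) volume (-1) 1 := by
  refine (intervalIntegrable_betaWeight hα hβ).continuousOn_mul ?_
  rw [uIcc_of_le (by norm_num)]
  exact hg.comp_continuousOn (continuousOn_segPt a b)

/-- The integral `∫ g(t(v)) (1 - v) ^ (α - 1) (1 + v) ^ (β - 1) dv` over the segment from `a` to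
`b`. -/
def segIntegral (α β : ℂ) (g : ℍ → ℂ) (a b : ℍ) : ℂ :=
  ∫ v in (-1 : ℝ)..1, g (segPt a b v) * betaWeight α β v

/-! ### Holomorphy and continuity of the line integral -/

/-- The point `((w₂ - w₁) v + (w₁ + w₂)) / 2` as a linear function of `(w₁, w₂)`. -/
def segLin (v : ℝ) : ℂ × ℂ →L[ℂ] ℂ :=
  (((1 - v) / 2 : ℝ) : ℂ) • ContinuousLinearMap.fst ℂ ℂ ℂ +
    (((1 + v) / 2 : ℝ) : ℂ) • ContinuousLinearMap.snd ℂ ℂ ℂ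

theorem segLin_apply (v : ℝ) (p : ℂ × ℂ) :
    segLin v p = ((p.2 - p.1) * v + (p.1 + p.2)) / 2 := by
  simp [segLin]
  ring

theorem continuous_segLin : Continuous segLin := by
  unfold segLin
  fun_prop

theorem ofComplex_segLin (a b : ℍ) (v : ℝ) : ofComplex (segLin v (a, b)) = segPt a b v := by
  rw [segLin_apply, segPt]

theorem segLin_im_pos {p : ℂ × ℂ} (h₁ : 0 < p.1.im) (h₂ : 0 < p.2.im) {v : ℝ}
    (hv : v ∈ Icc (-1 : ℝ) 1) : 0 < (segLin v p).im := by
  rw [segLin_apply]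
  exact segPt_im_pos ⟨p.1, h₁⟩ ⟨p.2, h₂⟩ hv

theorem isOpen_prod_upperHalfPlane : IsOpen {p : ℂ × ℂ | 0 < p.1.im ∧ 0 < p.2.im} :=
  (isOpen_lt continuous_const (Complex.continuous_im.comp continuous_fst)).inter
    (isOpen_lt continuous_const (Complex.continuous_im.comp continuous_snd))

/-- Differentiation under the integral sign in both endpoints at once: the derivative of the
non-weight factor is bounded on a closed ball times `[-1, 1]` by compactness, so a multiple of the
norm of the weight dominates. -/
theorem differentiableAt_integral_segLin {α β : ℂ} (hα : 0 < α.re) (hβ : 0 < β.re) {g : ℍ → ℂ}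
    (hg : MDifferentiable 𝓘(ℂ) 𝓘(ℂ) g) {p₀ : ℂ × ℂ} (h₁ : 0 < p₀.1.im) (h₂ : 0 < p₀.2.im) :
    DifferentiableAt ℂ (fun p : ℂ × ℂ => ∫ v in (-1 : ℝ)..1,
      g (ofComplex (segLin v p)) * betaWeight α β v) p₀ := by
  set G : ℂ → ℂ := g ∘ ofComplex with hG
  have hGd : DifferentiableOn ℂ G {z | 0 < z.im} := mdifferentiable_iff.1 hg
  have hO : IsOpen {z : ℂ | 0 < z.im} := isOpen_upperHalfPlaneSet
  have hGc : ContinuousOn G {z | 0 < z.im} := hGd.continuousOn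
  have hG'c : ContinuousOn (deriv G) {z | 0 < z.im} := (hGd.deriv hO).continuousOn
  obtain ⟨ε, hε, hball⟩ := Metric.nhds_basis_closedBall.mem_iff.1
    (isOpen_prod_upperHalfPlane.mem_nhds ⟨h₁, h₂⟩)
  have hseg : ∀ p ∈ Metric.closedBall p₀ ε, ∀ v ∈ Icc (-1 : ℝ) 1, 0 < (segLin v p).im :=
    fun p hp v hv => segLin_im_pos (hball hp).1 (hball hp).2 hv
  have hcont : Continuous fun q : (ℂ × ℂ) × ℝ => segLin q.2 q.1 :=
    (continuous_segLin.comp continuous_snd).clm_apply continuous_fst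
  have hD : ContinuousOn (fun q : (ℂ × ℂ) × ℝ => deriv G (segLin q.2 q.1) • segLin q.2)
      (Metric.closedBall p₀ ε ×ˢ Icc (-1 : ℝ) 1) :=
    (hG'c.comp hcont.continuousOn fun q hq => hseg q.1 hq.1 q.2 hq.2).smul
      (continuous_segLin.comp continuous_snd).continuousOn
  obtain ⟨C, hC⟩ := ((isCompact_closedBall p₀ ε).prod isCompact_Icc).exists_bound_of_continuousOn hD
  have hW := intervalIntegrable_betaWeight hα hβ
  have hIoc : uIoc (-1 : ℝ) 1 ⊆ Icc (-1) 1 := by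
    rw [uIoc_of_le (by norm_num)]
    exact Ioc_subset_Icc_self
  have hu : uIcc (-1 : ℝ) 1 = Icc (-1) 1 := uIcc_of_le (by norm_num)
  have hint : ∀ p ∈ Metric.closedBall p₀ ε,
      IntervalIntegrable (fun v => G (segLin v p) * betaWeight α β v) volume (-1) 1 := by
    intro p hp
    refine hW.continuousOn_mul ?_
    rw [hu]
    have hc : Continuous fun v => segLin v p := continuous_segLin.clm_apply continuous_const
    exact hGc.comp hc.continuousOn fun v hv => hseg p hp v hv
  have hint' : IntervalIntegrable
      (fun v => betaWeight α β v • (deriv G (segLin v p₀) • segLin v)) volume (-1) 1 := by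
    refine hW.smul_continuousOn ?_
    rw [hu]
    have hc : Continuous fun v => segLin v p₀ := continuous_segLin.clm_apply continuous_const
    exact (hG'c.comp hc.continuousOn fun v hv =>
      hseg p₀ (Metric.mem_closedBall_self hε.le) v hv).smul continuous_segLin.continuousOn
  have hp₀ := Metric.mem_closedBall_self (x := p₀) hε.le
  refine (intervalIntegral.hasFDerivAt_integral_of_dominated_of_fderiv_le
    (F := fun p v => G (segLin v p) * betaWeight α β v)
    (F' := fun p v => betaWeight α β v • (deriv G (segLin v p) • segLin v))
    (bound := fun v => ‖betaWeight α β v‖ * C)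
    (Metric.closedBall_mem_nhds p₀ hε) ?_ (hint p₀ hp₀)
    ?_ ?_ (hW.norm.mul_const C) ?_).differentiableAt
  · filter_upwards [Metric.closedBall_mem_nhds p₀ hε] with p hp
    exact (hint p hp).def'.aestronglyMeasurable
  · exact hint'.def'.aestronglyMeasurable
  · refine Eventually.of_forall fun v hv p hp => ?_
    rw [norm_smul]
    exact mul_le_mul_of_nonneg_left (hC (p, v) ⟨hp, hIoc hv⟩) (norm_nonneg _)
  · refine Eventually.of_forall fun v hv p hp => ?_
    have hd : HasDerivAt G (deriv G (segLin v p)) (segLin v p) :=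
      (hGd.differentiableAt (hO.mem_nhds (hseg p hp v (hIoc hv)))).hasDerivAt
    have := (hd.comp_hasFDerivAt p (segLin v).hasFDerivAt).mul_const (betaWeight α β v)
    exact this

theorem mdifferentiable_segIntegral {α β : ℂ} (hα : 0 < α.re) (hβ : 0 < β.re) {g : ℍ → ℂ}
    (hg : MDifferentiable 𝓘(ℂ) 𝓘(ℂ) g) :
    MDifferentiable (𝓘(ℂ).prod 𝓘(ℂ)) 𝓘(ℂ)
      (fun p : ℍ × ℍ => segIntegral α β g p.1 p.2) := by
  intro p
  have h := (differentiableAt_integral_segLin hα hβ hg (p₀ := ((p.1 : ℂ), (p.2 : ℂ)))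
    p.1.im_pos p.2.im_pos).mdifferentiableAt
  have hc : MDifferentiableAt (𝓘(ℂ).prod 𝓘(ℂ)) 𝓘(ℂ, ℂ × ℂ)
      (fun q : ℍ × ℍ => ((q.1 : ℂ), (q.2 : ℂ))) p :=
    ((mdifferentiable_coe _).comp p mdifferentiableAt_fst).prodMk_space
      ((mdifferentiable_coe _).comp p mdifferentiableAt_snd)
  have := h.comp p hc
  refine this.congr_of_eventuallyEq (Eventually.of_forall fun q => ?_)
  simp only [segIntegral, Function.comp, ofComplex_segLin]

/-- Joint continuity in the function and the endpoints is what yields, by currying, continuity of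
the operator for the compact-open topologies. -/
theorem continuous_segIntegral {α β : ℂ} (hα : 0 < α.re) (hβ : 0 < β.re) :
    Continuous fun q : C(ℍ, ℂ) × (ℍ × ℍ) => segIntegral α β q.1 q.2.1 q.2.2 := by
  have hev : Continuous fun r : (C(ℍ, ℂ) × (ℍ × ℍ)) × Icc (-1 : ℝ) 1 =>
      r.1.1 (segPt r.1.2.1 r.1.2.2 r.2) :=
    Continuous.eval (by fun_prop)
      (continuous_segPt (by fun_prop) (by fun_prop) (by fun_prop) fun r => r.2.2)
  -- The restriction of the function to the segment depends continuously on all data in sup norm;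
  -- this supplies a local uniform bound for dominated convergence.
  let Φ : C(ℍ, ℂ) × (ℍ × ℍ) → C(Icc (-1 : ℝ) 1, ℂ) := fun q =>
    ⟨fun v => q.1 (segPt q.2.1 q.2.2 v), 
      Continuous.eval continuous_const
        (continuous_segPt continuous_const continuous_const (by fun_prop) fun v => v.2)⟩
  have hΦ : Continuous Φ := ContinuousMap.continuous_of_continuous_uncurry Φ hev
  rw [continuous_iff_continuousAt]
  intro q₀
  have hW := intervalIntegrable_betaWeight hα hβ
  have hIoc : uIoc (-1 : ℝ) 1 ⊆ Icc (-1) 1 := by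
    rw [uIoc_of_le (by norm_num)]
    exact Ioc_subset_Icc_self
  have hnear : ∀ᶠ q in 𝓝 q₀, ‖Φ q‖ < ‖Φ q₀‖ + 1 :=
    (hΦ.norm.tendsto q₀).eventually_lt_const (lt_add_one _)
  refine intervalIntegral.continuousAt_of_dominated_interval
    (bound := fun v => (‖Φ q₀‖ + 1) * ‖betaWeight α β v‖) ?_ ?_ (hW.norm.const_mul _) ?_
  · refine Eventually.of_forall fun q => ?_
    exact (intervalIntegrable_comp_segPt_mul hα hβ q.1.continuous
      q.2.1 q.2.2).def'.aestronglyMeasurable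
  · filter_upwards [hnear] with q hq
    refine Eventually.of_forall fun v hv => ?_
    rw [norm_mul]
    exact mul_le_mul_of_nonneg_right (((Φ q).norm_coe_le_norm ⟨v, hIoc hv⟩).trans hq.le)
      (norm_nonneg _)
  · refine Eventually.of_forall fun v hv => ?_
    have : Continuous fun q : C(ℍ, ℂ) × (ℍ × ℍ) => q.1 (segPt q.2.1 q.2.2 v) :=
      Continuous.eval (by fun_prop)
        (continuous_segPt (by fun_prop) (by fun_prop) continuous_const fun _ => hIoc hv)
    exact (this.mul continuous_const).continuousAt

/-- The constant in front of the line integral. -/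
def psiConst (l₁ l₂ : ℂ) (ℓ : ℕ) : ℂ :=
  ((2 : ℂ) ^ (l₁ + l₂ + 2 * ℓ - 1) * (ℓ.factorial : ℂ))⁻¹

theorem psiIntegral_eq (l₁ l₂ : ℂ) (ℓ : ℕ) (g : ℍ → ℂ) (a b : ℍ) :
    psiIntegral l₁ l₂ ℓ g a b =
      psiConst l₁ l₂ ℓ * ((a : ℂ) - b) ^ ℓ * segIntegral (l₁ + ℓ) (l₂ + ℓ) g a b := by
  rw [psiIntegral, psiIntegrand_eq, segIntegral, psiConst, div_eq_mul_inv]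
  ring

theorem mdifferentiable_psiIntegral {l₁ l₂ : ℂ} {ℓ : ℕ} (h₁ : 0 < (l₁ + ℓ).re)
    (h₂ : 0 < (l₂ + ℓ).re) {g : ℍ → ℂ} (hg : MDifferentiable 𝓘(ℂ) 𝓘(ℂ) g) :
    MDifferentiable (𝓘(ℂ).prod 𝓘(ℂ)) 𝓘(ℂ)
      (fun p : ℍ × ℍ => psiIntegral l₁ l₂ ℓ g p.1 p.2) := by
  simp only [psiIntegral_eq]
  have hd : Differentiable ℂ fun p : ℂ × ℂ => psiConst l₁ l₂ ℓ * (p.1 - p.2) ^ ℓ := by fun_prop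
  have hc : MDifferentiable (𝓘(ℂ).prod 𝓘(ℂ)) 𝓘(ℂ, ℂ × ℂ)
      (fun q : ℍ × ℍ => ((q.1 : ℂ), (q.2 : ℂ))) := fun p =>
    ((mdifferentiable_coe _).comp p mdifferentiableAt_fst).prodMk_space
      ((mdifferentiable_coe _).comp p mdifferentiableAt_snd)
  exact (hd.mdifferentiable.comp hc).mul (mdifferentiable_segIntegral h₁ h₂ hg)

theorem segIntegral_add {α β : ℂ} (hα : 0 < α.re) (hβ : 0 < β.re) {f g : ℍ → ℂ}
    (hf : Continuous f) (hg : Continuous g) (a b : ℍ) :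
    segIntegral α β (f + g) a b = segIntegral α β f a b + segIntegral α β g a b := by
  simp only [segIntegral, Pi.add_apply, add_mul]
  exact intervalIntegral.integral_add (intervalIntegrable_comp_segPt_mul hα hβ hf a b)
    (intervalIntegrable_comp_segPt_mul hα hβ hg a b)

theorem segIntegral_smul (α β c : ℂ) (f : ℍ → ℂ) (a b : ℍ) :
    segIntegral α β (c • f) a b = c * segIntegral α β f a b := by
  simp only [segIntegral, Pi.smul_apply, smul_eq_mul, mul_assoc]
  exact intervalIntegral.integral_const_mul _ _

/-- The operator `Ψ : O(Π) → O(Π × Π)`. -/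
def psiCLM {l₁ l₂ : ℂ} {ℓ : ℕ} (h₁ : 0 < (l₁ + ℓ).re) (h₂ : 0 < (l₂ + ℓ).re) :
    HolPi →L[ℂ] HolPi2 where
  toFun g := ⟨⟨fun p => psiIntegral l₁ l₂ ℓ g.1 p.1 p.2,
    (mdifferentiable_psiIntegral h₁ h₂ g.2).continuous⟩, mdifferentiable_psiIntegral h₁ h₂ g.2⟩
  map_add' f g := by
    ext p
    have := segIntegral_add h₁ h₂ f.1.continuous g.1.continuous p.1 p.2
    simp only [ContinuousMap.coe_mk, psiIntegral_eq, Submodule.coe_add, ContinuousMap.coe_add,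
      ContinuousMap.add_apply, this, mul_add]
  map_smul' c f := by
    ext p
    have := segIntegral_smul (l₁ + ℓ) (l₂ + ℓ) c f.1 p.1 p.2
    simp only [ContinuousMap.coe_mk, psiIntegral_eq, Submodule.coe_smul, ContinuousMap.coe_smul,
      ContinuousMap.smul_apply, this, RingHom.id_apply, smul_eq_mul]
    ring
  cont := by
    refine Continuous.subtype_mk (ContinuousMap.continuous_of_continuous_uncurry _ ?_) _
    have h := (continuous_segIntegral h₁ h₂).comp
      ((continuous_subtype_val (p := fun f : C(ℍ, ℂ) => f ∈ HolPi)).prodMap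
        (continuous_id (X := ℍ × ℍ)))
    have h' : Continuous fun q : HolPi × (ℍ × ℍ) =>
        psiConst l₁ l₂ ℓ * ((q.2.1 : ℂ) - q.2.2) ^ ℓ := by fun_prop
    refine (h'.mul h).congr fun q => ?_
    exact (psiIntegral_eq l₁ l₂ ℓ q.1.1 q.2.1 q.2.2).symm

theorem psiCLM_apply {l₁ l₂ : ℂ} {ℓ : ℕ} (h₁ : 0 < (l₁ + ℓ).re) (h₂ : 0 < (l₂ + ℓ).re)
    (g : HolPi) (p : ℍ × ℍ) : (psiCLM h₁ h₂ g).1 p = psiIntegral l₁ l₂ ℓ g.1 p.1 p.2 := rfl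

/-! ### Transformation of the line integral under fractional linear maps -/

/-- The fractional linear substitution of `[-1, 1]` fixing the end points with multiplier `t`. -/
def segSubst (t v : ℝ) : ℝ := ((1 + v) - t * (1 - v)) / ((1 + v) + t * (1 - v))

theorem segSubst_denom_pos {t v : ℝ} (ht : 0 < t) (hv : v ∈ Icc (-1 : ℝ) 1) :
    0 < (1 + v) + t * (1 - v) := by
  rcases le_or_gt v 0 with h | h
  · nlinarith [hv.1, mul_pos ht (show (0 : ℝ) < 1 - v by linarith)]
  · nlinarith [mul_nonneg ht.le (show (0 : ℝ) ≤ 1 - v by linarith [hv.2])]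

theorem one_sub_segSubst {t v : ℝ} (h : (1 + v) + t * (1 - v) ≠ 0) :
    1 - segSubst t v = t * ((1 - v) * (((1 + v) + t * (1 - v)) / 2)⁻¹) := by
  rw [segSubst]
  field_simp
  ring

theorem one_add_segSubst {t v : ℝ} (h : (1 + v) + t * (1 - v) ≠ 0) :
    1 + segSubst t v = (1 + v) * (((1 + v) + t * (1 - v)) / 2)⁻¹ := by
  rw [segSubst]
  field_simp
  ring

theorem hasDerivAt_segSubst {t v : ℝ} (h : (1 + v) + t * (1 - v) ≠ 0) :
    HasDerivAt (segSubst t) (t * ((((1 + v) + t * (1 - v)) / 2) ^ 2)⁻¹) v := by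
  have h1 : HasDerivAt (fun v : ℝ => (1 + v) - t * (1 - v)) (1 + t) v := by
    have := ((hasDerivAt_id v).const_add 1).sub (((hasDerivAt_id v).const_sub 1).const_mul t)
    exact this.congr_deriv (by ring)
  have h2 : HasDerivAt (fun v : ℝ => (1 + v) + t * (1 - v)) (1 - t) v := by
    have := ((hasDerivAt_id v).const_add 1).add (((hasDerivAt_id v).const_sub 1).const_mul t)
    exact this.congr_deriv (by ring)
  refine (h1.div h2 h).congr_deriv ?_
  field_simp
  ring

theorem segSubst_mem_Ioo {t v : ℝ} (ht : 0 < t) (hv : v ∈ Ioo (-1 : ℝ) 1) :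
    segSubst t v ∈ Ioo (-1 : ℝ) 1 := by
  have h := segSubst_denom_pos ht (Ioo_subset_Icc_self hv)
  have h1 : 0 < 1 - segSubst t v := by
    rw [one_sub_segSubst h.ne']
    have : 0 < 1 - v := by linarith [hv.2]
    positivity
  have h2 : 0 < 1 + segSubst t v := by
    rw [one_add_segSubst h.ne']
    have : 0 < 1 + v := by linarith [hv.1]
    positivity
  exact ⟨by linarith, by linarith⟩

theorem segSubst_segSubst_inv {t v : ℝ} (ht : 0 < t) (hv : v ∈ Ioo (-1 : ℝ) 1) :
    segSubst t (segSubst t⁻¹ v) = v := by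
  have h := segSubst_denom_pos (inv_pos.2 ht) (Ioo_subset_Icc_self hv)
  rw [segSubst, one_add_segSubst h.ne', one_sub_segSubst h.ne', mul_inv_cancel_left₀ ht.ne']
  have hs : ((1 + v) + t⁻¹ * (1 - v)) / 2 ≠ 0 := by positivity
  generalize ((1 + v) + t⁻¹ * (1 - v)) / 2 = s at hs ⊢
  have h2 : (1 + v) * s⁻¹ + (1 - v) * s⁻¹ = 2 * s⁻¹ := by ring
  rw [h2]
  field_simp
  ring

theorem image_segSubst {t : ℝ} (ht : 0 < t) : segSubst t '' Ioo (-1) 1 = Ioo (-1) 1 := by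
  refine Subset.antisymm (image_subset_iff.2 fun v hv => segSubst_mem_Ioo ht hv) fun v hv => ?_
  exact ⟨segSubst t⁻¹ v, segSubst_mem_Ioo (inv_pos.2 ht) hv, segSubst_segSubst_inv ht hv⟩

theorem injOn_segSubst {t : ℝ} (ht : 0 < t) : InjOn (segSubst t) (Ioo (-1) 1) := by
  intro x hx y hy hxy
  have h1 := segSubst_segSubst_inv (inv_pos.2 ht) hx
  have h2 := segSubst_segSubst_inv (inv_pos.2 ht) hy
  rw [inv_inv] at h1 h2
  rw [← h1, ← h2, hxy]

/-- With `s = ((1 + v) + t (1 - v)) / 2`, the substitution multiplies `1 - v` by `t / s` and `1 + v`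
by `1 / s`, and has derivative `t / s ^ 2`. The derivative turns the exponents `α - 1` and `α + β -
2` of `t` and `1 / s` into `α` and `α + β`. -/
theorem betaWeight_segSubst (α β : ℂ) {t v : ℝ} (ht : 0 < t) (hv : v ∈ Ioo (-1 : ℝ) 1) :
    ((t * ((((1 + v) + t * (1 - v)) / 2) ^ 2)⁻¹ : ℝ) : ℂ) * betaWeight α β (segSubst t v) =
      (t : ℂ) ^ α * (((((1 + v) + t * (1 - v)) / 2 : ℝ) : ℂ) ^ (-(α + β)) * betaWeight α β v) := by
  have h := segSubst_denom_pos ht (Ioo_subset_Icc_self hv)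
  simp only [betaWeight]
  rw [one_sub_segSubst h.ne', one_add_segSubst h.ne']
  set s : ℝ := ((1 + v) + t * (1 - v)) / 2 with hs
  have hs0 : 0 < s := by positivity
  have h1 : 0 < 1 - v := by linarith [hv.2]
  have h2 : 0 < 1 + v := by linarith [hv.1]
  rw [Complex.ofReal_mul t ((1 - v) * s⁻¹), Complex.mul_cpow_ofReal_nonneg ht.le (by positivity),
    Complex.ofReal_mul (1 - v) s⁻¹, Complex.mul_cpow_ofReal_nonneg h1.le (by positivity),
    Complex.ofReal_mul (1 + v) s⁻¹, Complex.mul_cpow_ofReal_nonneg h2.le (by positivity)]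
  have hs' : (s : ℂ) ≠ 0 := Complex.ofReal_ne_zero.2 hs0.ne'
  have ht' : (t : ℂ) ≠ 0 := Complex.ofReal_ne_zero.2 ht.ne'
  have harg : (s : ℂ).arg ≠ Real.pi := by
    rw [Complex.arg_ofReal_of_nonneg hs0.le]
    exact Real.pi_ne_zero.symm
  rw [Complex.ofReal_inv, Complex.inv_cpow _ _ harg, Complex.inv_cpow _ _ harg,
    Complex.cpow_sub _ _ ht', Complex.cpow_sub _ _ hs', Complex.cpow_sub _ _ hs',
    Complex.cpow_neg, Complex.cpow_add _ _ hs', Complex.cpow_one, Complex.cpow_one]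
  have e1 : (s : ℂ) ^ α ≠ 0 := by simp [Complex.cpow_eq_zero_iff, hs']
  have e2 : (s : ℂ) ^ β ≠ 0 := by simp [Complex.cpow_eq_zero_iff, hs']
  push_cast
  field_simp

theorem integral_segSubst (α β : ℂ) {t : ℝ} (ht : 0 < t) (k : ℝ → ℂ) :
    ∫ v in (-1 : ℝ)..1, k v * betaWeight α β v =
      (t : ℂ) ^ α * ∫ v in (-1 : ℝ)..1, k (segSubst t v) *
        ((((((1 + v) + t * (1 - v)) / 2 : ℝ) : ℂ) ^ (-(α + β))) * betaWeight α β v) := by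
  rw [intervalIntegral.integral_of_le (by norm_num), intervalIntegral.integral_of_le (by norm_num),
    integral_Ioc_eq_integral_Ioo, integral_Ioc_eq_integral_Ioo]
  conv_lhs => rw [← image_segSubst ht]
  rw [integral_image_eq_integral_abs_deriv_smul measurableSet_Ioo
    (f' := fun v => t * ((((1 + v) + t * (1 - v)) / 2) ^ 2)⁻¹)
    (fun v hv => (hasDerivAt_segSubst
      (segSubst_denom_pos ht (Ioo_subset_Icc_self hv)).ne').hasDerivWithinAt) (injOn_segSubst ht),
    ← integral_const_mul]
  refine setIntegral_congr_fun measurableSet_Ioo fun v hv => ?_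
  have h := segSubst_denom_pos ht (Ioo_subset_Icc_self hv)
  have h' := betaWeight_segSubst α β ht hv
  simp only [Complex.real_smul]
  rw [abs_of_pos (by positivity), mul_left_comm, h']
  ring

/-- A continuous logarithm of an affine function along a segment on which the affine function has
constant argument. -/
theorem log_affine_segPt {c d : ℂ} {φ : ℍ → ℂ} (hφ : Continuous φ)
    (hexp : ∀ z : ℍ, Complex.exp (φ z) = c * z + d) {a b : ℍ} {t : ℝ} (ht : 0 < t)
    (hab : c * (a : ℂ) + d = t * (c * (b : ℂ) + d)) {v : ℝ} (hv : v ∈ Icc (-1 : ℝ) 1) :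
    φ (segPt a b v) = φ b + Real.log (((1 + v) + t * (1 - v)) / 2) := by
  set s : ℝ → ℝ := fun v => ((1 + v) + t * (1 - v)) / 2 with hs
  have hspos : ∀ v ∈ Icc (-1 : ℝ) 1, 0 < s v := fun v hv => by
    have := segSubst_denom_pos ht hv
    simp only [hs]
    positivity
  set δ : ℝ → ℂ := fun v => φ (segPt a b v) - φ b - (Real.log (s v) : ℂ) with hδ
  have hδexp : ∀ v ∈ Icc (-1 : ℝ) 1, Complex.exp (δ v) = 1 := by
    intro v hv
    have hJ : c * (segPt a b v : ℂ) + d = (s v : ℂ) * (c * b + d) := by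
      rw [coe_segPt a b hv]
      simp only [hs]
      push_cast
      linear_combination ((1 - v) / 2 : ℂ) * hab
    have hb : c * (b : ℂ) + d ≠ 0 := by
      rw [← hexp]
      exact Complex.exp_ne_zero _
    have hs0 : ((s v : ℝ) : ℂ) ≠ 0 := Complex.ofReal_ne_zero.2 (hspos v hv).ne'
    simp only [hδ]
    rw [Complex.exp_sub, Complex.exp_sub, hexp, hexp, hJ, ← Complex.ofReal_exp,
      Real.exp_log (hspos v hv)]
    field_simp
  have hδc : ContinuousOn δ (Icc (-1) 1) := by
    refine ((hφ.comp_continuousOn (continuousOn_segPt a b)).sub continuousOn_const).sub ?_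
    refine Complex.continuous_ofReal.comp_continuousOn (ContinuousOn.log ?_ ?_)
    · exact Continuous.continuousOn (by fun_prop)
    · exact fun v hv => (hspos v hv).ne'
  have hδ1 : δ 1 = 0 := by
    have : segPt a b 1 = b := by
      ext
      rw [coe_segPt a b (by norm_num)]
      push_cast
      ring
    simp [hδ, hs, this]
  -- `δ` takes values in `2 π i ℤ`, is continuous on a connected interval and vanishes at `v = 1`,
  -- hence vanishes throughout.
  choose! n hn using fun v (hv : v ∈ Icc (-1 : ℝ) 1) => Complex.exp_eq_one_iff.1 (hδexp v hv)
  have hnc : ContinuousOn n (Icc (-1 : ℝ) 1) := by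
    rw [Int.isClosedEmbedding_coe_real.isInducing.continuousOn_iff]
    have : ContinuousOn (fun v => (δ v / (2 * Real.pi * Complex.I)).re) (Icc (-1) 1) :=
      Complex.continuous_re.comp_continuousOn (hδc.div_const _)
    refine this.congr fun v hv => ?_
    simp only [Function.comp]
    rw [hn v hv, mul_div_assoc, div_self Complex.two_pi_I_ne_zero]
    simp
  have hnv : n v = n 1 := isPreconnected_Icc.constant hnc hv (by norm_num)
  have hδv : δ v = 0 := by
    rw [hn v hv, hnv, ← hn 1 (by norm_num), hδ1]
  have := hδv
  simp only [hδ] at this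
  linear_combination this

/-- Along the segment `c z + d` equals a positive real function of `v` times `c q + d`, so dividing
the affine function `a z + b` by it stays on the segment between the images, at parameter `segSubst
t v`. No determinant condition enters; `h` may even be constant. -/
theorem segIntegral_comp_of_real_ratio (α β : ℂ) {a b c d : ℂ} {φ : ℍ → ℂ} (hφ : Continuous φ)
    (hexp : ∀ z : ℍ, Complex.exp (φ z) = c * z + d) {h : ℍ → ℍ}
    (hh : ∀ z : ℍ, (c * z + d) * (h z : ℂ) = a * z + b) (g : ℍ → ℂ) {p q : ℍ} {t : ℝ}
    (ht : 0 < t) (hpq : c * (p : ℂ) + d = t * (c * (q : ℂ) + d)) :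
    segIntegral α β (fun z => Complex.exp (-(α + β) * φ z) * g (h z)) p q =
      Complex.exp (-α * φ p) * Complex.exp (-β * φ q) * segIntegral α β g (h p) (h q) := by
  have hp : φ p = φ q + Real.log t := by
    have := log_affine_segPt hφ hexp ht hpq (v := -1) (by norm_num)
    have e : segPt p q (-1) = p := by
      ext
      rw [coe_segPt p q (by norm_num)]
      push_cast
      ring
    rw [e] at this
    rw [this]
    congr 3
    ring
  have ht' : (t : ℂ) ≠ 0 := Complex.ofReal_ne_zero.2 ht.ne'
  have hpow : Complex.exp (-α * φ p) * (t : ℂ) ^ α = Complex.exp (-α * φ q) := by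
    rw [Complex.cpow_def_of_ne_zero ht', ← Complex.exp_add, hp, ← Complex.ofReal_log ht.le]
    congr 1
    ring
  conv_rhs => rw [segIntegral, integral_segSubst α β ht]
  rw [mul_left_comm, ← mul_assoc, ← mul_assoc, mul_comm ((t : ℂ) ^ α), hpow, ← Complex.exp_add,
    ← intervalIntegral.integral_const_mul, segIntegral]
  refine intervalIntegral.integral_congr fun v hv => ?_
  rw [uIcc_of_le (by norm_num)] at hv
  have hs := segSubst_denom_pos ht hv
  have hs' : (0 : ℝ) < ((1 + v) + t * (1 - v)) / 2 := by positivity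
  have hs'' : ((((1 + v) + t * (1 - v)) / 2 : ℝ) : ℂ) ≠ 0 := Complex.ofReal_ne_zero.2 hs'.ne'
  have hσ : segSubst t v ∈ Icc (-1 : ℝ) 1 := by
    have h1 : 0 ≤ 1 - segSubst t v := by
      rw [one_sub_segSubst hs.ne']
      have : 0 ≤ 1 - v := by linarith [hv.2]
      positivity
    have h2 : 0 ≤ 1 + segSubst t v := by
      rw [one_add_segSubst hs.ne']
      have : 0 ≤ 1 + v := by linarith [hv.1]
      positivity
    exact ⟨by linarith, by linarith⟩
  have hpt : h (segPt p q v) = segPt (h p) (h q) (segSubst t v) := by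
    ext
    rw [coe_segPt _ _ hσ]
    have hq0 : c * (q : ℂ) + d ≠ 0 := by
      rw [← hexp]
      exact Complex.exp_ne_zero _
    have hJ : c * (segPt p q v : ℂ) + d =
        ((((1 + v) + t * (1 - v)) / 2 : ℝ) : ℂ) * (c * q + d) := by
      rw [coe_segPt p q hv]
      push_cast
      linear_combination ((1 - v) / 2 : ℂ) * hpq
    have h0 := hh (segPt p q v)
    rw [hJ] at h0
    have e1 : (1 : ℂ) - (segSubst t v : ℂ) =
        t * ((1 - v) * ((((1 + v) + t * (1 - v)) / 2 : ℝ) : ℂ)⁻¹) := by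
      exact_mod_cast congrArg (fun x : ℝ => (x : ℂ)) (one_sub_segSubst hs.ne')
    have e2 : (1 : ℂ) + (segSubst t v : ℂ) =
        (1 + v) * ((((1 + v) + t * (1 - v)) / 2 : ℝ) : ℂ)⁻¹ := by
      exact_mod_cast congrArg (fun x : ℝ => (x : ℂ)) (one_add_segSubst hs.ne')
    have e3 : (((h q : ℂ) - h p) * (segSubst t v : ℂ) + (h p + h q)) / 2 =
        (1 - (segSubst t v : ℂ)) / 2 * h p + (1 + (segSubst t v : ℂ)) / 2 * h q := by ring
    rw [e3, e1, e2]
    set S : ℂ := ((((1 + v) + t * (1 - v)) / 2 : ℝ) : ℂ) with hS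
    refine mul_left_cancel₀ (mul_ne_zero hs'' hq0) ?_
    rw [h0, coe_segPt p q hv]
    have hp' := hh p
    have hq' := hh q
    rw [hpq] at hp'
    field_simp
    linear_combination (-(1 - v) : ℂ) * hp' - (1 + v : ℂ) * hq'
  have hlog := log_affine_segPt hφ hexp ht hpq hv
  simp only [hpt, hlog]
  rw [Complex.cpow_def_of_ne_zero hs'', ← Complex.ofReal_log hs'.le]
  have : Complex.exp (-(α + β) * (φ q + (Real.log (((1 + v) + t * (1 - v)) / 2) : ℂ))) =
      Complex.exp (-α * φ q + -β * φ q) *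
        Complex.exp ((Real.log (((1 + v) + t * (1 - v)) / 2) : ℂ) * -(α + β)) := by
    rw [← Complex.exp_add]
    congr 1
    ring
  rw [this]
  ring

/-- The transformation rule of the line integral under a fractional linear map `h` with denominator
`c z + d = exp (φ z)`. -/
theorem segIntegral_comp {α β : ℂ} (hα : 0 < α.re) (hβ : 0 < β.re) {a b c d : ℂ} {φ : ℍ → ℂ}
    (hφ : MDifferentiable 𝓘(ℂ) 𝓘(ℂ) φ) (hexp : ∀ z : ℍ, Complex.exp (φ z) = c * z + d)
    {h : ℍ → ℍ} (hhd : MDifferentiable 𝓘(ℂ) 𝓘(ℂ) h)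
    (hh : ∀ z : ℍ, (c * z + d) * (h z : ℂ) = a * z + b) {g : ℍ → ℂ}
    (hg : MDifferentiable 𝓘(ℂ) 𝓘(ℂ) g) (p q : ℍ) :
    segIntegral α β (fun z => Complex.exp (-(α + β) * φ z) * g (h z)) p q =
      Complex.exp (-α * φ p) * Complex.exp (-β * φ q) * segIntegral α β g (h p) (h q) := by
  by_cases hc : c = 0
  -- A constant denominator has ratio `t = 1` for every pair.
  · exact segIntegral_comp_of_real_ratio α β hφ.continuous hexp hh g one_pos (by simp [hc])
  have hexpd : ∀ s : ℂ, MDifferentiable 𝓘(ℂ) 𝓘(ℂ) (fun z : ℍ => Complex.exp (s * φ z)) := by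
    intro s
    have h : Differentiable ℂ (fun w : ℂ => Complex.exp (s * w)) := by fun_prop
    exact h.mdifferentiable.comp hφ
  have hpair : MDifferentiable 𝓘(ℂ) (𝓘(ℂ).prod 𝓘(ℂ)) (fun z : ℍ => (z, q)) :=
    mdifferentiable_id.prodMk mdifferentiable_const
  have hpair' : MDifferentiable 𝓘(ℂ) (𝓘(ℂ).prod 𝓘(ℂ)) (fun z : ℍ => (h z, h q)) :=
    hhd.prodMk mdifferentiable_const
  have hL₀ := mdifferentiable_segIntegral hα hβ ((hexpd (-(α + β))).mul (hg.comp hhd))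
  have hR₀ := mdifferentiable_segIntegral hα hβ hg
  have hL : MDifferentiable 𝓘(ℂ) 𝓘(ℂ) (fun z : ℍ =>
      segIntegral α β (fun z => Complex.exp (-(α + β) * φ z) * g (h z)) z q) :=
    MDifferentiable.comp (f := fun z : ℍ => (z, q)) hL₀ hpair
  have hR : MDifferentiable 𝓘(ℂ) 𝓘(ℂ) (fun z : ℍ =>
      Complex.exp (-α * φ z) * Complex.exp (-β * φ q) * segIntegral α β g (h z) (h q)) :=
    ((hexpd _).mul mdifferentiable_const).mul
      (MDifferentiable.comp (f := fun z : ℍ => (h z, h q)) hR₀ hpair')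
  have hzero := eq_zero_of_frequently (τ := q) (hL.sub hR) ?_
  · exact sub_eq_zero.1 (congrFun hzero p)
  have hq0 : c * (q : ℂ) + d ≠ 0 := by
    rw [← hexp]
    exact Complex.exp_ne_zero _
  -- `r t` solves `c (r t) + d = t (c q + d)`. It passes through `q` at `t = 1`, so the real-ratio
  -- points accumulate there, as the identity theorem requires.
  set r : ℝ → ℂ := fun t => (t * (c * (q : ℂ) + d) - d) / c with hr
  have hrc : Continuous r := by fun_prop
  have hr1 : r 1 = q := by
    simp only [hr]
    push_cast
    field_simp
    ring
  have him : ∀ᶠ t in 𝓝[≠] (1 : ℝ), 0 < (r t).im := by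
    refine ((Complex.continuous_im.comp hrc).tendsto 1).eventually_const_lt ?_ |>.filter_mono
      nhdsWithin_le_nhds
    simp only [Function.comp, hr1]
    exact q.im_pos
  have hpos : ∀ᶠ t in 𝓝[≠] (1 : ℝ), 0 < t :=
    (lt_mem_nhds one_pos).filter_mono nhdsWithin_le_nhds
  have hne : ∀ᶠ t in 𝓝[≠] (1 : ℝ), t ≠ 1 := eventually_mem_nhdsWithin
  have htend : Tendsto (fun t => ofComplex (r t)) (𝓝[≠] 1) (𝓝[≠] q) := by
    rw [tendsto_nhdsWithin_iff]
    constructor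
    · have h1 : ContinuousAt (fun t => ofComplex (r t)) 1 := by
        refine ContinuousAt.comp ?_ hrc.continuousAt
        exact (mdifferentiableAt_ofComplex (by rw [hr1]; exact q.im_pos)).continuousAt
      have h2 := h1.tendsto
      rw [hr1, ofComplex_apply] at h2
      exact h2.mono_left nhdsWithin_le_nhds
    · filter_upwards [him, hne] with t ht1 ht2 hcontra
      apply ht2
      have : (r t) = q := by
        rw [← hcontra, ofComplex_apply_of_im_pos ht1]
      simp only [hr] at this
      rw [div_eq_iff hc] at this
      have h3 : ((t : ℂ) - 1) * (c * q + d) = 0 := by linear_combination this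
      have h4 := (mul_eq_zero.1 h3).resolve_right hq0
      exact_mod_cast sub_eq_zero.1 h4
  refine htend.frequently (Eventually.frequently ?_)
  filter_upwards [him, hpos] with t ht1 ht2
  refine sub_eq_zero.2 ?_
  refine segIntegral_comp_of_real_ratio α β hφ.continuous hexp hh g ht2 ?_
  rw [ofComplex_apply_of_im_pos ht1]
  simp only [hr]
  field_simp
  ring

/-- The line integral contributes exponents `-(l₁ + ℓ)` and `-(l₂ + ℓ)`. Since the determinant is
one, `ζ₁ - ζ₂` is the difference of the images times both denominators; its `ℓ`-th power restores
`-l₁` and `-l₂`. -/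
theorem psiCLM_piRep {l₁ l₂ l₃ : ℂ} {ℓ : ℕ} (hℓ : (l₃ - l₁ - l₂) / 2 = (ℓ : ℂ))
    (h₁ : 0 < (l₁ + ℓ).re) (h₂ : 0 < (l₂ + ℓ).re) (a : SL2Tilde) (g : HolPi) :
    psiCLM h₁ h₂ (piRep l₃ a g) = tensorRep l₁ l₂ a (psiCLM h₁ h₂ g) := by
  have hl : l₃ = (l₁ + ℓ) + (l₂ + ℓ) := by linear_combination 2 * hℓ
  have hne : ∀ z : ℍ, ((a⁻¹.g 1 0 : ℝ) : ℂ) * z + ((a⁻¹.g 1 1 : ℝ) : ℂ) ≠ 0 := fun z =>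
    UpperHalfPlane.denom_ne_zero (a⁻¹.g : GL (Fin 2) ℝ) z
  have hmob : ∀ z : ℍ, (((a⁻¹.g 1 0 : ℝ) : ℂ) * z + ((a⁻¹.g 1 1 : ℝ) : ℂ)) *
      ((a⁻¹.g • z : ℍ) : ℂ) = ((a⁻¹.g 0 0 : ℝ) : ℂ) * z + ((a⁻¹.g 0 1 : ℝ) : ℂ) := by
    intro z
    have h1 : ((a⁻¹.g • z : ℍ) : ℂ) = (((a⁻¹.g 0 0 : ℝ) : ℂ) * z + ((a⁻¹.g 0 1 : ℝ) : ℂ)) /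
        (((a⁻¹.g 1 0 : ℝ) : ℂ) * z + ((a⁻¹.g 1 1 : ℝ) : ℂ)) :=
      UpperHalfPlane.coe_specialLinearGroup_apply a⁻¹.g z
    rw [h1, mul_div_cancel₀ _ (hne z)]
  have hdet : ((a⁻¹.g 0 0 : ℝ) : ℂ) * ((a⁻¹.g 1 1 : ℝ) : ℂ) -
      ((a⁻¹.g 0 1 : ℝ) : ℂ) * ((a⁻¹.g 1 0 : ℝ) : ℂ) = 1 := by
    have := a⁻¹.g.det_coe
    rw [Matrix.det_fin_two] at this
    exact_mod_cast this
  refine Subtype.ext (ContinuousMap.ext fun p => ?_)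
  have key := segIntegral_comp h₁ h₂ a⁻¹.holo a⁻¹.exp_φ (mdifferentiable_sl_smul a⁻¹.g)
    hmob g.2 p.1 p.2
  rw [← hl] at key
  have hlhs : (psiCLM h₁ h₂ (piRep l₃ a g)).1 p = psiConst l₁ l₂ ℓ * ((p.1 : ℂ) - p.2) ^ ℓ *
      segIntegral (l₁ + ℓ) (l₂ + ℓ) (fun z => Complex.exp (-l₃ * a⁻¹.φ z) * g.1 (a⁻¹.g • z))
        p.1 p.2 := psiIntegral_eq l₁ l₂ ℓ _ p.1 p.2
  have hrhs : (tensorRep l₁ l₂ a (psiCLM h₁ h₂ g)).1 p =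
      autFactor l₁ a⁻¹ p.1 * autFactor l₂ a⁻¹ p.2 *
        psiIntegral l₁ l₂ ℓ g.1 (a⁻¹.g • p.1) (a⁻¹.g • p.2) := rfl
  rw [hlhs, hrhs, key, psiIntegral_eq]
  set A := a⁻¹
  have hdiff : ((p.1 : ℂ) - p.2) = Complex.exp (A.φ p.1) * Complex.exp (A.φ p.2) *
      (((A.g • p.1 : ℍ) : ℂ) - ((A.g • p.2 : ℍ) : ℂ)) := by
    rw [A.exp_φ, A.exp_φ]
    have k1 := hmob p.1
    have k2 := hmob p.2
    linear_combination (-(((A.g 1 0 : ℝ) : ℂ) * p.2 + ((A.g 1 1 : ℝ) : ℂ))) * k1 +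
      (((A.g 1 0 : ℝ) : ℂ) * p.1 + ((A.g 1 1 : ℝ) : ℂ)) * k2 - ((p.1 : ℂ) - p.2) * hdet
  have haut : ∀ (l : ℂ) (z : ℍ), Complex.exp (-(l + ℓ) * A.φ z) * Complex.exp (A.φ z) ^ ℓ =
      autFactor l A z := by
    intro l z
    rw [autFactor, ← Complex.exp_nat_mul, ← Complex.exp_add]
    congr 1
    ring
  rw [← haut, ← haut, hdiff, mul_pow, mul_pow]
  ring

/-! ### Radial weights on the unit disc -/

theorem integrable_iff_integrableOn_polarCoord (f : ℂ → ℂ) :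
    Integrable f ↔ IntegrableOn (fun p : ℝ × ℝ => p.1 • f (Complex.polarCoord.symm p))
      polarCoord.target := by
  have h2 : Integrable (fun p => f (Complex.measurableEquivRealProd.symm p)) ↔
      IntegrableOn (fun p => f (Complex.measurableEquivRealProd.symm p))
        (polarCoord.symm '' polarCoord.target) := by
    rw [polarCoord.symm_image_target_eq_source,
      integrableOn_congr_set_ae polarCoord_source_ae_eq_univ, integrableOn_univ]
  have h1 : Integrable f ↔
      Integrable (fun p => f (Complex.measurableEquivRealProd.symm p)) :=
    ((Complex.volume_preserving_equiv_real_prod.symm).integrable_comp_emb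
      Complex.measurableEquivRealProd.symm.measurableEmbedding).symm
  rw [h1, h2, integrableOn_image_iff_integrableOn_abs_det_fderiv_smul volume
    polarCoord.open_target.measurableSet
    (fun p _ => (hasFDerivAt_polarCoord_symm p).hasFDerivWithinAt) polarCoord.symm.injOn]
  refine integrableOn_congr_fun (fun p hp => ?_) polarCoord.open_target.measurableSet
  simp only [det_fderivPolarCoordSymm]
  rw [abs_of_pos hp.1]
  rfl

theorem integral_polar {f : ℂ → ℂ} (hf : Integrable f) :
    ∫ z, f z = ∫ r in Ioi (0 : ℝ), ∫ θ in Ioo (-Real.pi) Real.pi,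
      r • f (Complex.polarCoord.symm (r, θ)) := by
  have h := (integrable_iff_integrableOn_polarCoord f).1 hf
  rw [← Complex.integral_comp_polarCoord_symm f]
  exact setIntegral_prod _ h

/-- The weight `(1 - ‖ζ‖ ^ 2) ^ (l - 2)` on the unit disc. -/
def discWeight (l : ℝ) (z : ℂ) : ℝ := (1 - ‖z‖ ^ 2) ^ (l - 2)

theorem integrableOn_one_sub_sq_rpow {l : ℝ} (hl : 1 < l) :
    IntegrableOn (fun r : ℝ => r * (1 - r ^ 2) ^ (l - 2)) (Ioo 0 1) := by
  have h : IntegrableOn (fun r : ℝ => r * (1 - r ^ 2) ^ (l - 2)) (Ioc 0 1) := by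
    -- The integrand is the nonnegative derivative of a function that stays continuous at `r = 1`
    -- exactly because `l > 1`.
    refine intervalIntegral.integrableOn_deriv_of_nonneg
      (g := fun r : ℝ => -((1 - r ^ 2) ^ (l - 1) / (2 * (l - 1)))) ?_ ?_ ?_
    · refine (ContinuousOn.div_const (ContinuousOn.rpow_const (by fun_prop) ?_) _).neg
      exact fun x _ => Or.inr (by linarith)
    · intro x hx
      have hpos : 0 < 1 - x ^ 2 := by nlinarith [hx.1, hx.2]
      have h1 : HasDerivAt (fun r : ℝ => 1 - r ^ 2) (-(2 * x)) x := by
        have := (hasDerivAt_pow 2 x).const_sub 1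
        exact this.congr_deriv (by simp)
      have h2 := ((h1.rpow_const (p := l - 1) (Or.inl hpos.ne')).div_const (2 * (l - 1))).neg
      refine h2.congr_deriv ?_
      have e : l - 1 - 1 = l - 2 := by ring
      have hl' : l - 1 ≠ 0 := by linarith
      rw [e]
      field_simp
    · intro x hx
      have hpos : 0 < 1 - x ^ 2 := by nlinarith [hx.1, hx.2]
      exact mul_nonneg hx.1.le (Real.rpow_nonneg hpos.le _)
  exact h.mono_set Ioo_subset_Ioc_self

theorem integrableOn_discWeight {l : ℝ} (hl : 1 < l) :
    IntegrableOn (fun z => (discWeight l z : ℂ)) (Metric.ball 0 1) := by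
  rw [← integrable_indicator_iff Metric.isOpen_ball.measurableSet,
    integrable_iff_integrableOn_polarCoord]
  have h1 : Integrable (fun r : ℝ =>
      (Ioo (0 : ℝ) 1).indicator (fun r => r * (1 - r ^ 2) ^ (l - 2)) r)
      (volume.restrict (Ioi 0)) :=
    ((integrable_indicator_iff measurableSet_Ioo).2 (integrableOn_one_sub_sq_rpow hl)).mono_measure
      Measure.restrict_le_self
  have h2 : Integrable (fun _ : ℝ => (1 : ℝ)) (volume.restrict (Ioo (-Real.pi) Real.pi)) :=
    integrable_const _
  have h3 := (h1.mul_prod h2).ofReal (𝕜 := ℂ)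
  rw [Measure.prod_restrict] at h3
  refine IntegrableOn.congr_fun h3 (fun p hp => ?_) polarCoord.open_target.measurableSet
  have hp0 : 0 < p.1 := hp.1
  by_cases hp1 : p.1 < 1
  · have hb : Complex.polarCoord.symm p ∈ Metric.ball (0 : ℂ) 1 := by
      rw [mem_ball_zero_iff, Complex.norm_polarCoord_symm, abs_of_pos hp0]
      exact hp1
    simp only [indicator_of_mem hb, indicator_of_mem (show p.1 ∈ Ioo (0 : ℝ) 1 from ⟨hp0, hp1⟩),
      discWeight, Complex.norm_polarCoord_symm, abs_of_pos hp0, mul_one, Complex.real_smul]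
    simp
  · have hb : Complex.polarCoord.symm p ∉ Metric.ball (0 : ℂ) 1 := by
      rw [mem_ball_zero_iff, Complex.norm_polarCoord_symm, abs_of_pos hp0]
      exact hp1
    rw [indicator_of_notMem hb, indicator_of_notMem (fun h => hp1 h.2)]
    simp

theorem integral_circle_eq {G : ℂ → ℂ} (hG : DifferentiableOn ℂ G (Metric.ball 0 1)) {r : ℝ}
    (hr : r ∈ Ioo (0 : ℝ) 1) :
    ∫ θ in Ioo (-Real.pi) Real.pi, G (Complex.polarCoord.symm (r, θ)) = 2 * Real.pi * G 0 := by
  have hmv : Real.circleAverage G 0 r = G 0 := by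
    refine DiffContOnCl.circleAverage (hG.diffContOnCl_ball ?_)
    rw [abs_of_pos hr.1]
    exact Metric.closedBall_subset_ball hr.2
  have hper : Function.Periodic (fun θ => G (circleMap 0 r θ)) (2 * Real.pi) := fun θ => by
    simp only [periodic_circleMap 0 r θ]
  have h1 := hper.intervalIntegral_add_eq 0 (-Real.pi)
  rw [zero_add, show -Real.pi + 2 * Real.pi = Real.pi by ring] at h1
  rw [Real.circleAverage_def, h1, intervalIntegral.integral_of_le (by linarith [Real.pi_pos]),
    integral_Ioc_eq_integral_Ioo, Complex.real_smul] at hmv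
  have h2 : ∀ θ, Complex.polarCoord.symm (r, θ) = circleMap 0 r θ := fun θ => by
    rw [Complex.polarCoord_symm_apply, circleMap, Complex.exp_mul_I]
    simp
  simp only [h2]
  rw [← hmv]
  push_cast
  field_simp

/-- The weight is radial, so on each circle the mean value property replaces `G` by `G 0`. Applying
the same formula to `G = 1` identifies the constant without evaluating the radial integral. -/
theorem integral_discWeight_mul {l : ℝ} (hl : 1 < l) {G : ℂ → ℂ}
    (hG : DifferentiableOn ℂ G (Metric.ball 0 1))
    (hint : IntegrableOn (fun z => (discWeight l z : ℂ) * G z) (Metric.ball 0 1)) :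
    ∫ z in Metric.ball (0 : ℂ) 1, (discWeight l z : ℂ) * G z =
      (∫ z in Metric.ball (0 : ℂ) 1, (discWeight l z : ℂ)) * G 0 := by
  have key : ∀ {G : ℂ → ℂ}, DifferentiableOn ℂ G (Metric.ball 0 1) →
      IntegrableOn (fun z => (discWeight l z : ℂ) * G z) (Metric.ball 0 1) →
      ∫ z in Metric.ball (0 : ℂ) 1, (discWeight l z : ℂ) * G z =
        (∫ r in Ioi (0 : ℝ), (Ioo (0 : ℝ) 1).indicator
          (fun r => (r : ℂ) * (((1 - r ^ 2) ^ (l - 2) : ℝ) : ℂ) * (2 * Real.pi)) r) * G 0 := by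
    intro G hG hint
    rw [← integral_indicator Metric.isOpen_ball.measurableSet,
      integral_polar ((integrable_indicator_iff Metric.isOpen_ball.measurableSet).2 hint),
      ← integral_mul_const]
    refine setIntegral_congr_fun measurableSet_Ioi fun r hr => ?_
    have hr0 : 0 < r := hr
    by_cases hr1 : r < 1
    · have hb : ∀ θ, Complex.polarCoord.symm (r, θ) ∈ Metric.ball (0 : ℂ) 1 := fun θ => by
        rw [mem_ball_zero_iff, Complex.norm_polarCoord_symm, abs_of_pos hr0]
        exact hr1
      simp only [indicator_of_mem (hb _), discWeight, Complex.norm_polarCoord_symm,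
        abs_of_pos hr0, indicator_of_mem (show r ∈ Ioo (0 : ℝ) 1 from ⟨hr0, hr1⟩),
        Complex.real_smul]
      rw [integral_const_mul, integral_const_mul, integral_circle_eq hG ⟨hr0, hr1⟩]
      ring
    · have hb : ∀ θ, Complex.polarCoord.symm (r, θ) ∉ Metric.ball (0 : ℂ) 1 := fun θ => by
        rw [mem_ball_zero_iff, Complex.norm_polarCoord_symm, abs_of_pos hr0]
        exact hr1
      simp only [indicator_of_notMem (hb _), smul_zero, integral_zero]
      rw [indicator_of_notMem (by simp [hr1]), zero_mul]
  have h1 := key (G := fun _ => 1) (differentiableOn_const _)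
    (by simpa using integrableOn_discWeight hl)
  simp only [mul_one] at h1
  rw [key hG hint, h1]

theorem integral_discWeight_pos {l : ℝ} (hl : 1 < l) :
    0 < ∫ z in Metric.ball (0 : ℂ) 1, discWeight l z := by
  have hint : IntegrableOn (discWeight l) (Metric.ball 0 1) := by
    have h := (integrableOn_discWeight hl).re
    simp only [RCLike.re_to_complex, Complex.ofReal_re] at h
    exact h
  rw [setIntegral_pos_iff_support_of_nonneg_ae _ hint]
  · have : Function.support (discWeight l) ∩ Metric.ball 0 1 = Metric.ball 0 1 := by
      refine inter_eq_right.2 fun z hz => ?_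
      rw [mem_ball_zero_iff] at hz
      have : 0 < 1 - ‖z‖ ^ 2 := by nlinarith [norm_nonneg z]
      exact (Real.rpow_pos_of_pos this _).ne'
    rw [this]
    exact Metric.measure_ball_pos _ _ one_pos
  · filter_upwards [ae_restrict_mem Metric.isOpen_ball.measurableSet] with z hz
    rw [mem_ball_zero_iff] at hz
    have : 0 < 1 - ‖z‖ ^ 2 := by nlinarith [norm_nonneg z]
    exact (Real.rpow_pos_of_pos this _).le

/-! ### The Bergman kernel -/

/-- The affine function `-i (z - conj w)`, whose real part is positive. -/
def kerBase (w z : ℂ) : ℂ := -Complex.I * (z - conj w)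

theorem kerBase_re (w z : ℂ) : (kerBase w z).re = z.im + w.im := by
  simp [kerBase]

theorem kerBase_re_pos (w z : ℍ) : 0 < (kerBase w z).re := by
  rw [kerBase_re]
  exact add_pos z.im_pos w.im_pos

theorem kerBase_mem_slitPlane (w z : ℍ) : kerBase w z ∈ Complex.slitPlane :=
  Or.inl (kerBase_re_pos w z)

theorem kerBase_ne_zero (w z : ℍ) : kerBase w z ≠ 0 :=
  Complex.slitPlane_ne_zero (kerBase_mem_slitPlane w z)

theorem conj_kerBase (w z : ℂ) : conj (kerBase w z) = kerBase z w := by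
  simp [kerBase]
  ring

/-- The function `(-i (z - conj w)) ^ (-s)`. -/
def bergKer (s : ℝ) (w z : ℍ) : ℂ := Complex.exp (-(s : ℂ) * Complex.log (kerBase w z))

theorem bergKer_ne_zero (s : ℝ) (w z : ℍ) : bergKer s w z ≠ 0 := Complex.exp_ne_zero _

theorem conj_bergKer (s : ℝ) (w z : ℍ) : conj (bergKer s w z) = bergKer s z w := by
  rw [bergKer, bergKer, ← Complex.exp_conj, ← conj_kerBase, Complex.log_conj]
  · simp
  · intro h
    have := kerBase_re_pos z w
    have h2 := Complex.arg_eq_pi_iff.1 h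
    linarith [h2.1]

theorem norm_bergKer (s : ℝ) (w z : ℍ) : ‖bergKer s w z‖ = ‖kerBase w z‖ ^ (-s) := by
  rw [bergKer, Complex.norm_exp, Real.rpow_def_of_pos (norm_pos_iff.2 (kerBase_ne_zero w z))]
  simp [Complex.log_re]
  ring

theorem bergKer_add (s t : ℝ) (w z : ℍ) : bergKer (s + t) w z = bergKer s w z * bergKer t w z := by
  rw [bergKer, bergKer, bergKer, ← Complex.exp_add]
  push_cast
  ring_nf

theorem bergKer_nat (k : ℕ) (w z : ℍ) : bergKer k w z = (kerBase w z ^ k)⁻¹ := by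
  rw [bergKer, neg_mul, Complex.exp_neg]
  push_cast
  rw [Complex.exp_nat_mul, Complex.exp_log (kerBase_ne_zero w z)]

theorem bergKer_self (s : ℝ) (w : ℍ) : bergKer s w w = (((2 * w.im) ^ (-s) : ℝ) : ℂ) := by
  have h : kerBase w w = ((2 * w.im : ℝ) : ℂ) := by
    apply Complex.ext
    · simp [kerBase]
      ring
    · simp [kerBase]
  have hp : 0 < 2 * w.im := by linarith [w.im_pos]
  rw [bergKer, h, Real.rpow_def_of_pos hp, ← Complex.ofReal_log hp.le]
  push_cast
  ring_nf

theorem mdifferentiable_log_kerBase (w : ℍ) :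
    MDifferentiable 𝓘(ℂ) 𝓘(ℂ) (fun z : ℍ => Complex.log (kerBase w z)) := by
  intro z
  have h : DifferentiableAt ℂ (fun z : ℂ => Complex.log (kerBase w z)) z := by
    refine DifferentiableAt.clog ?_ (kerBase_mem_slitPlane w z)
    unfold kerBase
    fun_prop
  exact h.mdifferentiableAt.comp z (mdifferentiable_coe z)

theorem mdifferentiable_bergKer (s : ℝ) (w : ℍ) :
    MDifferentiable 𝓘(ℂ) 𝓘(ℂ) (bergKer s w) := by
  have h : Differentiable ℂ (fun u : ℂ => Complex.exp (-(s : ℂ) * u)) := by fun_prop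
  exact h.mdifferentiable.comp (mdifferentiable_log_kerBase w)

theorem bergKer_mul_conj (s : ℝ) (w z : ℍ) :
    bergKer s w z * conj (bergKer s w z) = ((‖kerBase w z‖ ^ (-2 * s) : ℝ) : ℂ) := by
  rw [Complex.mul_conj, Complex.normSq_eq_norm_sq, norm_bergKer, ← Real.rpow_natCast,
    ← Real.rpow_mul (norm_nonneg _)]
  congr 2
  push_cast
  ring

/-! ### Cayley transform -/

/-- The Cayley transform from the unit disc onto the upper half plane with `0 ↦ w`. -/
def cayley (w z : ℂ) : ℂ := (w - conj w * z) / (1 - z)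

theorem one_sub_ne_zero_of_mem_ball {z : ℂ} (hz : z ∈ Metric.ball (0 : ℂ) 1) : 1 - z ≠ 0 := by
  intro h
  rw [mem_ball_zero_iff, ← sub_eq_zero.1 h] at hz
  simp at hz

theorem cayley_zero (w : ℂ) : cayley w 0 = w := by simp [cayley]

theorem cayley_im (w : ℂ) {z : ℂ} (hz : z ∈ Metric.ball (0 : ℂ) 1) :
    (cayley w z).im = w.im * (1 - ‖z‖ ^ 2) / ‖1 - z‖ ^ 2 := by
  have h := one_sub_ne_zero_of_mem_ball hz
  have h' : Complex.normSq (1 - z) ≠ 0 := by simpa using h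
  rw [cayley, Complex.div_im, ← Complex.normSq_eq_norm_sq, ← Complex.normSq_eq_norm_sq]
  field_simp
  simp [Complex.normSq_apply]
  ring

theorem cayley_im_pos (w : ℍ) {z : ℂ} (hz : z ∈ Metric.ball (0 : ℂ) 1) :
    0 < (cayley w z).im := by
  rw [cayley_im _ hz]
  have h := one_sub_ne_zero_of_mem_ball hz
  rw [mem_ball_zero_iff] at hz
  have h1 : 0 < 1 - ‖z‖ ^ 2 := by nlinarith [norm_nonneg z]
  have := w.im_pos
  rw [coe_im]
  positivity

theorem kerBase_cayley (w : ℂ) {z : ℂ} (hz : z ∈ Metric.ball (0 : ℂ) 1) :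
    kerBase w (cayley w z) = ((2 * w.im : ℝ) : ℂ) / (1 - z) := by
  have h := one_sub_ne_zero_of_mem_ball hz
  have h2 : w - conj w = (2 * w.im : ℝ) * Complex.I := Complex.sub_conj w
  rw [kerBase, cayley]
  field_simp
  push_cast at h2 ⊢
  linear_combination (-Complex.I) * h2 - 2 * w.im * Complex.I_mul_I

theorem hasDerivAt_cayley (w : ℂ) {z : ℂ} (hz : z ∈ Metric.ball (0 : ℂ) 1) :
    HasDerivAt (cayley w) ((w - conj w) / (1 - z) ^ 2) z := by
  have h := one_sub_ne_zero_of_mem_ball hz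
  have h1 : HasDerivAt (fun z : ℂ => w - conj w * z) (-conj w) z := by
    have := ((hasDerivAt_id z).const_mul (conj w)).const_sub w
    exact this.congr_deriv (by simp)
  have h2 : HasDerivAt (fun z : ℂ => 1 - z) (-1) z := by
    simpa using (hasDerivAt_id z).const_sub 1
  refine (h1.div h2 h).congr_deriv ?_
  field_simp
  ring

theorem cayley_image (w : ℍ) : cayley w '' Metric.ball 0 1 = {z : ℂ | 0 < z.im} := by
  refine Subset.antisymm (image_subset_iff.2 fun z hz => cayley_im_pos w hz) fun z hz => ?_
  have hz' : (0 : ℝ) < z.im := hz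
  have hw := w.im_pos
  have hne : z - conj (w : ℂ) ≠ 0 := by
    intro h
    have := congrArg Complex.im h
    simp at this
    linarith
  refine ⟨(z - w) / (z - conj (w : ℂ)), ?_, ?_⟩
  · rw [mem_ball_zero_iff, norm_div, div_lt_one (norm_pos_iff.2 hne)]
    refine lt_of_pow_lt_pow_left₀ 2 (norm_nonneg _) ?_
    rw [← Complex.normSq_eq_norm_sq, ← Complex.normSq_eq_norm_sq]
    simp only [Complex.normSq_apply, Complex.sub_re, Complex.sub_im, Complex.conj_re,
      Complex.conj_im, coe_im, coe_re]
    nlinarith [mul_pos hz' hw]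
  · have hw2 : (w : ℂ) - conj (w : ℂ) ≠ 0 := by
      intro h
      have := congrArg Complex.im h
      simp at this
      linarith
    have e : 1 - (z - w) / (z - conj (w : ℂ)) = (w - conj (w : ℂ)) / (z - conj (w : ℂ)) := by
      field_simp
      ring
    rw [cayley, e]
    field_simp
    ring

theorem cayley_injOn (w : ℍ) : InjOn (cayley w) (Metric.ball 0 1) := by
  intro x hx y hy hxy
  have h1 := one_sub_ne_zero_of_mem_ball hx
  have h2 := one_sub_ne_zero_of_mem_ball hy
  have hw := w.im_pos
  have hw2 : (w : ℂ) - conj (w : ℂ) ≠ 0 := by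
    intro h
    have := congrArg Complex.im h
    simp at this
    linarith
  rw [cayley, cayley, div_eq_div_iff h1 h2] at hxy
  refine mul_left_cancel₀ hw2 ?_
  linear_combination hxy

/-! ### Integration over the half plane -/

theorem measurable_bergmanDensity (l : ℝ) :
    Measurable fun z : ℍ => ENNReal.ofReal (z.im ^ (l - 2)) := by
  have : Measurable fun z : ℍ => z.im := UpperHalfPlane.continuous_im.measurable
  fun_prop

instance (l : ℝ) : SigmaFinite (bergmanMeasure l) :=
  SigmaFinite.withDensity_ofReal _

instance (l : ℝ) : (bergmanMeasure l).IsOpenPosMeasure := by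
  refine ⟨fun U hU hne h0 => ?_⟩
  rw [bergmanMeasure, withDensity_apply _ hU.measurableSet,
    lintegral_eq_zero_iff (measurable_bergmanDensity l)] at h0
  have hz : (volume.comap UpperHalfPlane.coe).restrict U = 0 := by
    rw [← ae_eq_bot, ← Filter.eventually_false_iff_eq_bot]
    filter_upwards [h0] with z hz
    have : 0 < z.im ^ (l - 2) := Real.rpow_pos_of_pos z.im_pos _
    simp only [Pi.zero_apply, ENNReal.ofReal_eq_zero] at hz
    linarith
  rw [Measure.restrict_eq_zero, measurableEmbedding_coe.comap_apply] at hz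
  exact (isOpenEmbedding_coe.isOpenMap U hU).measure_ne_zero volume (hne.image _) hz

theorem measurePreserving_coe : MeasurePreserving UpperHalfPlane.coe
    ((volume : Measure ℂ).comap UpperHalfPlane.coe) (volume.restrict {z : ℂ | 0 < z.im}) := by
  refine ⟨measurable_coe, ?_⟩
  rw [measurableEmbedding_coe.map_comap, range_coe]

theorem integrable_bergman_iff (l : ℝ) (f : ℍ → ℂ) :
    Integrable f (bergmanMeasure l) ↔
      IntegrableOn (fun z : ℂ => z.im ^ (l - 2) • f (ofComplex z)) {z : ℂ | 0 < z.im} := by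
  rw [IntegrableOn, ← measurePreserving_coe.integrable_comp_emb measurableEmbedding_coe,
    bergmanMeasure, integrable_withDensity_iff_integrable_smul' (measurable_bergmanDensity l)
      (Eventually.of_forall fun z => ENNReal.ofReal_lt_top)]
  refine integrable_congr (Eventually.of_forall fun z => ?_)
  simp only [Function.comp, ofComplex_apply, coe_im]
  rw [ENNReal.toReal_ofReal (Real.rpow_nonneg z.im_pos.le _)]

theorem integral_bergman (l : ℝ) (f : ℍ → ℂ) :
    ∫ z, f z ∂(bergmanMeasure l) =
      ∫ z in {z : ℂ | 0 < z.im}, z.im ^ (l - 2) • f (ofComplex z) := by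
  rw [← measurePreserving_coe.integral_comp measurableEmbedding_coe, bergmanMeasure,
    integral_withDensity_eq_integral_toReal_smul (measurable_bergmanDensity l)
      (Eventually.of_forall fun z => ENNReal.ofReal_lt_top)]
  refine integral_congr_ae (Eventually.of_forall fun z => ?_)
  simp only [ofComplex_apply, coe_im]
  rw [ENNReal.toReal_ofReal (Real.rpow_nonneg z.im_pos.le _)]

/-- The real derivative of the Cayley transform. -/
def cayleyDeriv (w z : ℂ) : ℂ →L[ℝ] ℂ :=
  (ContinuousLinearMap.toSpanSingleton ℂ ((w - conj w) / (1 - z) ^ 2)).restrictScalars ℝ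

theorem det_cayleyDeriv (w z : ℂ) :
    (cayleyDeriv w z).det = ‖(w - conj w) / (1 - z) ^ 2‖ ^ 2 := by
  simp [cayleyDeriv, ContinuousLinearMap.det, LinearMap.det_restrictScalars,
    Algebra.norm_complex_eq, Complex.normSq_eq_norm_sq, div_pow]

/-- The powers of `‖1 - z‖` from the Jacobian, the height and the kernel are `-4`, `-2 (l - 2)` and
`2 l`, and cancel. Thus the Bergman measure times the squared modulus of the kernel at `w` becomes a
radial disc weight. -/
theorem jacobian_cayley (l : ℝ) (w : ℍ) {z : ℂ} (hz : z ∈ Metric.ball (0 : ℂ) 1) :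
    |(cayleyDeriv w z).det| * ((cayley w z).im ^ (l - 2) *
      ‖kerBase w (cayley w z)‖ ^ (-2 * l)) = 4 * (4 * w.im) ^ (-l) * discWeight l z := by
  have h := one_sub_ne_zero_of_mem_ball hz
  have hN : 0 < ‖1 - z‖ := norm_pos_iff.2 h
  have hy := w.im_pos
  have hw2 : ‖(w : ℂ) - conj (w : ℂ)‖ = 2 * w.im := by
    rw [Complex.sub_conj, norm_mul, Complex.norm_I, mul_one, Complex.norm_real,
      Real.norm_of_nonneg (by rw [coe_im]; positivity), coe_im]
  rw [det_cayleyDeriv, abs_of_nonneg (by positivity), kerBase_cayley _ hz, cayley_im _ hz,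
    discWeight, norm_div, norm_div, hw2, Complex.norm_real, norm_pow, coe_im,
    Real.norm_of_nonneg (by positivity)]
  have hz1 : 0 < 1 - ‖z‖ ^ 2 := by
    rw [mem_ball_zero_iff] at hz
    nlinarith [norm_nonneg z]
  generalize ‖1 - z‖ = N at hN ⊢
  generalize 1 - ‖z‖ ^ 2 = m at hz1 ⊢
  generalize w.im = y at hy ⊢
  -- All factors are positive, so taking logarithms reduces the identity to linear algebra in the
  -- exponents.
  refine Real.log_injOn_pos (mem_Ioi.2 (by positivity)) (mem_Ioi.2 (by positivity)) ?_
  have h4 : Real.log 4 = 2 * Real.log 2 := by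
    rw [show (4 : ℝ) = 2 ^ 2 by norm_num, Real.log_pow]
    norm_num
  rw [Real.log_mul (by positivity) (by positivity), Real.log_mul (by positivity) (by positivity),
    Real.log_mul (by positivity) (by positivity), Real.log_mul (by positivity) (by positivity),
    Real.log_rpow (by positivity), Real.log_rpow (by positivity), Real.log_rpow (by positivity),
    Real.log_rpow (by positivity), Real.log_pow, Real.log_div (by positivity) (by positivity),
    Real.log_div (by positivity) (by positivity), Real.log_div (by positivity) (by positivity),
    Real.log_pow, Real.log_mul (by positivity) (by positivity),
    Real.log_mul (by positivity) (by positivity), Real.log_mul (by positivity) (by positivity), h4]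
  push_cast
  ring

theorem integrableOn_cayley_iff (w : ℍ) (f : ℂ → ℂ) :
    IntegrableOn f {z : ℂ | 0 < z.im} ↔
      IntegrableOn (fun z => |(cayleyDeriv w z).det| • f (cayley w z)) (Metric.ball 0 1) := by
  rw [← cayley_image w]
  exact integrableOn_image_iff_integrableOn_abs_det_fderiv_smul volume
    Metric.isOpen_ball.measurableSet
    (fun z hz => ((hasDerivAt_cayley w hz).hasFDerivAt.restrictScalars ℝ).hasFDerivWithinAt)
    (cayley_injOn w) f

theorem integral_cayley (w : ℍ) (f : ℂ → ℂ) :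
    ∫ z in {z : ℂ | 0 < z.im}, f z =
      ∫ z in Metric.ball 0 1, |(cayleyDeriv w z).det| • f (cayley w z) := by
  rw [← cayley_image w]
  exact integral_image_eq_integral_abs_det_fderiv_smul volume
    Metric.isOpen_ball.measurableSet
    (fun z hz => ((hasDerivAt_cayley w hz).hasFDerivAt.restrictScalars ℝ).hasFDerivWithinAt)
    (cayley_injOn w) f

theorem cayley_integrand (l : ℝ) (w : ℍ) (F : ℍ → ℂ) {z : ℂ} (hz : z ∈ Metric.ball (0 : ℂ) 1) :
    |(cayleyDeriv w z).det| • ((cayley w z).im ^ (l - 2) •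
      (F (ofComplex (cayley w z)) *
        (bergKer l w (ofComplex (cayley w z)) * conj (bergKer l w (ofComplex (cayley w z)))))) =
      ((4 * (4 * w.im) ^ (-l) : ℝ) : ℂ) *
        ((discWeight l z : ℂ) * F (ofComplex (cayley w z))) := by
  have h := jacobian_cayley l w hz
  rw [bergKer_mul_conj, ofComplex_apply_of_im_pos (cayley_im_pos w hz)]
  rw [← mul_assoc ((4 * (4 * w.im) ^ (-l) : ℝ) : ℂ), ← Complex.ofReal_mul, ← h]
  simp only [Complex.real_smul]
  push_cast
  ring

theorem integrable_mul_bergKer_sq_iff (l : ℝ) (w : ℍ) (F : ℍ → ℂ) :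
    Integrable (fun z => F z * (bergKer l w z * conj (bergKer l w z))) (bergmanMeasure l) ↔
      IntegrableOn (fun z => (discWeight l z : ℂ) * F (ofComplex (cayley w z)))
        (Metric.ball 0 1) := by
  rw [integrable_bergman_iff, integrableOn_cayley_iff w,
    integrableOn_congr_fun (fun z hz => cayley_integrand l w F hz)
      Metric.isOpen_ball.measurableSet]
  have hc : ((4 * (4 * w.im) ^ (-l) : ℝ) : ℂ) ≠ 0 := by
    have := w.im_pos
    rw [Complex.ofReal_ne_zero]
    positivity
  exact integrable_const_mul_iff hc.isUnit _

theorem integral_mul_bergKer_sq (l : ℝ) (w : ℍ) (F : ℍ → ℂ) :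
    ∫ z, F z * (bergKer l w z * conj (bergKer l w z)) ∂(bergmanMeasure l) =
      ((4 * (4 * w.im) ^ (-l) : ℝ) : ℂ) *
        ∫ z in Metric.ball 0 1, (discWeight l z : ℂ) * F (ofComplex (cayley w z)) := by
  rw [integral_bergman, integral_cayley w, setIntegral_congr_fun Metric.isOpen_ball.measurableSet
    (fun z hz => cayley_integrand l w F hz), integral_const_mul]

theorem memLp_bergKer {l : ℝ} (hl : 1 < l) (w : ℍ) : MemLp (bergKer l w) 2 (bergmanMeasure l) := by
  have h := (integrable_mul_bergKer_sq_iff l w (fun _ => 1)).2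
    (by simpa using integrableOn_discWeight hl)
  rw [memLp_two_iff_integrable_sq_norm
    (mdifferentiable_bergKer l w).continuous.aestronglyMeasurable]
  refine h.re.congr (Eventually.of_forall fun z => ?_)
  simp only [one_mul, Complex.mul_conj, Complex.normSq_eq_norm_sq, RCLike.re_to_complex,
    Complex.ofReal_re]

/-- The constant of the reproducing formula. -/
def reproConst (l : ℝ) : ℝ := 4 * 2 ^ (-l) * ∫ z in Metric.ball (0 : ℂ) 1, discWeight l z

theorem reproConst_pos {l : ℝ} (hl : 1 < l) : 0 < reproConst l := by
  have := integral_discWeight_pos hl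
  unfold reproConst
  positivity

/-- The reproducing property of the Bergman kernel. -/
theorem integral_mul_conj_bergKer {l : ℝ} (hl : 1 < l) {f : ℍ → ℂ}
    (hf : MDifferentiable 𝓘(ℂ) 𝓘(ℂ) f) (w : ℍ)
    (hint : Integrable (fun z => f z * conj (bergKer l w z)) (bergmanMeasure l)) :
    ∫ z, f z * conj (bergKer l w z) ∂(bergmanMeasure l) = reproConst l * f w := by
  -- `F` is `f` divided by the kernel: it is holomorphic, and the integrand becomes `F` times the
  -- squared modulus of the kernel.
  set F : ℍ → ℂ := fun z => f z * Complex.exp ((l : ℂ) * Complex.log (kerBase w z)) with hF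
  have hFd : MDifferentiable 𝓘(ℂ) 𝓘(ℂ) F := by
    have h : Differentiable ℂ (fun u : ℂ => Complex.exp ((l : ℂ) * u)) := by fun_prop
    exact hf.mul (h.mdifferentiable.comp (mdifferentiable_log_kerBase w))
  have hinv : ∀ z : ℍ, Complex.exp ((l : ℂ) * Complex.log (kerBase w z)) * bergKer l w z = 1 := by
    intro z
    rw [bergKer, ← Complex.exp_add, neg_mul, add_neg_cancel, Complex.exp_zero]
  have hFf : (fun z => f z * conj (bergKer l w z)) =
      fun z => F z * (bergKer l w z * conj (bergKer l w z)) := by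
    ext z
    have := hinv z
    simp only [hF]
    linear_combination (-(f z * conj (bergKer l w z))) * this
  rw [hFf] at hint ⊢
  have hG : DifferentiableOn ℂ (fun z => F (ofComplex (cayley w z))) (Metric.ball 0 1) := by
    refine DifferentiableOn.comp (mdifferentiable_iff.1 hFd) (f := cayley w) ?_ ?_
    · exact fun z hz => (hasDerivAt_cayley w hz).differentiableAt.differentiableWithinAt
    · exact fun z hz => cayley_im_pos w hz
  rw [integral_mul_bergKer_sq, integral_discWeight_mul hl hG
    ((integrable_mul_bergKer_sq_iff l w F).1 hint), cayley_zero, ofComplex_apply]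
  have hw := w.im_pos
  have e1 : ((4 * w.im) ^ (-l) : ℝ) = 2 ^ (-l) * (2 * w.im) ^ (-l) := by
    rw [← Real.mul_rpow (by norm_num) (by positivity)]
    ring_nf
  have h1 := hinv w
  rw [bergKer_self] at h1
  have e2 : F w = f w * Complex.exp ((l : ℂ) * Complex.log (kerBase w w)) := rfl
  rw [e2, e1, reproConst, integral_complex_ofReal]
  push_cast
  linear_combination (4 * ((2 ^ (-l) : ℝ) : ℂ) *
    ((∫ z in Metric.ball (0 : ℂ) 1, discWeight l z : ℝ) : ℂ) * f w) * h1

/-! ### Inner products of kernels -/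

theorem im_le_norm_kerBase (w z : ℍ) : w.im ≤ ‖kerBase w z‖ := by
  have h := Complex.abs_re_le_norm (kerBase w z)
  rw [abs_of_pos (kerBase_re_pos w z), kerBase_re] at h
  have := z.im_pos
  simp only [coe_im] at h
  linarith

theorem memLp_bergKer_add {l : ℝ} (hl : 1 < l) (k : ℕ) (w : ℍ) :
    MemLp (bergKer (l + k) w) 2 (bergmanMeasure l) := by
  refine (memLp_bergKer hl w).of_le_mul (c := (w.im ^ k)⁻¹)
    (mdifferentiable_bergKer _ w).continuous.aestronglyMeasurable
    (Eventually.of_forall fun z => ?_)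
  rw [bergKer_add, norm_mul, mul_comm, bergKer_nat, norm_inv, norm_pow]
  have := w.im_pos
  gcongr
  exact im_le_norm_kerBase w z

theorem integrable_bergKer_mul {l : ℝ} (hl : 1 < l) (j k : ℕ) (w u : ℍ) :
    Integrable (fun z => bergKer (l + k) w z * bergKer (l + j) z u) (bergmanMeasure l) := by
  have h := (memLp_bergKer_add hl k w).integrable_mul (memLp_bergKer_add hl j u).star
  refine h.congr (Eventually.of_forall fun z => ?_)
  simp only [Pi.mul_apply, Pi.star_apply]
  rw [← conj_bergKer (l + j) u z]
  rfl

theorem hasDerivAt_exp_log_kerBase (s : ℝ) {w u : ℂ} (h : kerBase w u ∈ Complex.slitPlane) :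
    HasDerivAt (fun u => Complex.exp (-(s : ℂ) * Complex.log (kerBase w u)))
      (Complex.I * s * Complex.exp (-((s + 1 : ℝ) : ℂ) * Complex.log (kerBase w u))) u := by
  have h1 : HasDerivAt (fun u => kerBase w u) (-Complex.I) u := by
    have := ((hasDerivAt_id u).sub_const (conj w)).const_mul (-Complex.I)
    exact this.congr_deriv (by simp)
  have h0 := Complex.slitPlane_ne_zero h
  refine ((h1.clog h).const_mul (-(s : ℂ))).cexp.congr_deriv ?_
  have e : -((s + 1 : ℝ) : ℂ) * Complex.log (kerBase w u) =
      -(s : ℂ) * Complex.log (kerBase w u) - Complex.log (kerBase w u) := by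
    push_cast
    ring
  rw [e, Complex.exp_sub, Complex.exp_log h0]
  field_simp

/-- Moving `u₀` by less than half its height at most halves `‖kerBase z u₀‖`, uniformly in `z`. This
gives the integrable majorant for differentiating in the second point. -/
theorem norm_bergKer_le_of_mem_ball {s : ℝ} (hs : 0 ≤ s) (z u₀ u : ℍ)
    (hu : (u : ℂ) ∈ Metric.ball (u₀ : ℂ) (u₀.im / 2)) :
    ‖bergKer s z u‖ ≤ 2 ^ s * ‖bergKer s z u₀‖ := by
  have h1 : u₀.im ≤ ‖kerBase z u₀‖ := by
    have h := im_le_norm_kerBase u₀ z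
    rwa [← conj_kerBase, RCLike.norm_conj] at h
  have h2 : ‖kerBase z u₀‖ ≤ ‖kerBase z u‖ + u₀.im / 2 := by
    have e : kerBase z u₀ = kerBase z u + -Complex.I * (u₀ - u) := by
      simp only [kerBase]
      ring
    rw [e]
    refine (norm_add_le _ _).trans ?_
    gcongr
    rw [norm_mul, norm_neg, Complex.norm_I, one_mul, ← dist_eq_norm, dist_comm]
    exact (Metric.mem_ball.1 hu).le
  have h0 : 0 < ‖kerBase z u₀‖ := norm_pos_iff.2 (kerBase_ne_zero z u₀)
  have h3 : ‖kerBase z u₀‖ / 2 ≤ ‖kerBase z u‖ := by linarith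
  rw [norm_bergKer, norm_bergKer]
  refine (Real.rpow_le_rpow_of_nonpos (by positivity) h3 (by linarith)).trans_eq ?_
  rw [Real.div_rpow h0.le (by norm_num), Real.rpow_neg (x := 2) (by norm_num), div_inv_eq_mul,
    mul_comm]

theorem hasDerivAt_integral_bergKer_mul {l : ℝ} (hl : 1 < l) (j k : ℕ) (w u : ℍ) :
    HasDerivAt (fun v : ℂ => ∫ z, bergKer (l + k) w z *
      Complex.exp (-((l + j : ℝ) : ℂ) * Complex.log (kerBase z v)) ∂(bergmanMeasure l))
      (∫ z, Complex.I * ((l + j : ℝ) : ℂ) *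
        (bergKer (l + k) w z * bergKer (l + (j + 1 : ℕ)) z u) ∂(bergmanMeasure l)) u := by
  have hu := u.im_pos
  have hpos : ∀ v ∈ Metric.ball (u : ℂ) (u.im / 2), 0 < v.im := by
    intro v hv
    have h := Complex.abs_im_le_norm (v - u)
    rw [← dist_eq_norm] at h
    have h2 := abs_le.1 (h.trans (Metric.mem_ball.1 hv).le)
    rw [Complex.sub_im, coe_im] at h2
    linarith [h2.1]
  have hint := integrable_bergKer_mul hl (j + 1) k w u
  have e : l + ((j + 1 : ℕ) : ℝ) = l + j + 1 := by
    push_cast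
    ring
  refine (hasDerivAt_integral_of_dominated_loc_of_deriv_le
    (F := fun (v : ℂ) (z : ℍ) => bergKer (l + k) w z *
      Complex.exp (-((l + j : ℝ) : ℂ) * Complex.log (kerBase z v)))
    (F' := fun (v : ℂ) (z : ℍ) => Complex.I * ((l + j : ℝ) : ℂ) * (bergKer (l + k) w z *
      Complex.exp (-((l + j + 1 : ℝ) : ℂ) * Complex.log (kerBase z v))))
    (bound := fun z => ‖Complex.I * ((l + j : ℝ) : ℂ)‖ * (2 ^ (l + j + 1) *
      ‖bergKer (l + k) w z * bergKer (l + (j + 1 : ℕ)) z u‖))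
    (Metric.ball_mem_nhds (u : ℂ) (half_pos hu)) ?_ ?_ ?_ ?_ ?_ ?_).2.congr_deriv ?_
  · filter_upwards [Metric.ball_mem_nhds (u : ℂ) (half_pos hu)] with v hv
    exact (integrable_bergKer_mul hl j k w ⟨v, hpos v hv⟩).aestronglyMeasurable
  · exact integrable_bergKer_mul hl j k w u
  · rw [e] at hint
    exact (hint.const_mul _).aestronglyMeasurable
  · refine Eventually.of_forall fun z v hv => ?_
    have h := norm_bergKer_le_of_mem_ball (s := l + j + 1) (by positivity) z u ⟨v, hpos v hv⟩ hv
    rw [e, norm_mul, norm_mul (bergKer (l + k) w z), norm_mul (bergKer (l + k) w z)]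
    refine mul_le_mul_of_nonneg_left ?_ (norm_nonneg _)
    rw [mul_left_comm]
    exact mul_le_mul_of_nonneg_left h (norm_nonneg _)
  · exact (hint.norm.const_mul _).const_mul _
  · refine Eventually.of_forall fun z v hv => ?_
    have h := (hasDerivAt_exp_log_kerBase (l + j)
      (kerBase_mem_slitPlane z ⟨v, hpos v hv⟩)).const_mul (bergKer (l + k) w z)
    exact h.congr_deriv (by ring)
  · rw [e]
    rfl

/-- Induction on `j`: the case `j = 0` is the reproducing property, and differentiating in `u`
raises the kernel exponent by one on both sides. -/
theorem exists_integral_bergKer_mul {l : ℝ} (hl : 1 < l) (k j : ℕ) :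
    ∃ c : ℂ, ∀ w u : ℍ, ∫ z, bergKer (l + k) w z * bergKer (l + j) z u ∂(bergmanMeasure l) =
      c * bergKer (l + k + j) w u := by
  induction j with
  | zero =>
    refine ⟨reproConst l, fun w u => ?_⟩
    have h := integral_mul_conj_bergKer hl (mdifferentiable_bergKer (l + k) w) u
      (by
        have := integrable_bergKer_mul hl 0 k w u
        simpa only [conj_bergKer, Nat.cast_zero, add_zero] using this)
    simpa only [conj_bergKer, Nat.cast_zero, add_zero] using h
  | succ j ih =>
    obtain ⟨c, hc⟩ := ih
    have hlj : ((l + j : ℝ) : ℂ) ≠ 0 := by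
      rw [Complex.ofReal_ne_zero]
      positivity
    -- The derivatives bring down `i (l + j)` under the integral and `i (l + k + j)` outside; the
    -- constant picks up their quotient.
    refine ⟨c * ((l + k + j : ℝ) : ℂ) / ((l + j : ℝ) : ℂ), fun w u => ?_⟩
    have h1 := hasDerivAt_integral_bergKer_mul hl j k w u
    have h2 := (hasDerivAt_exp_log_kerBase (l + k + j) (kerBase_mem_slitPlane w u)).const_mul c
    have h3 : (fun v : ℂ => ∫ z, bergKer (l + k) w z *
        Complex.exp (-((l + j : ℝ) : ℂ) * Complex.log (kerBase z v)) ∂(bergmanMeasure l))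
        =ᶠ[𝓝 (u : ℂ)] fun v =>
          c * Complex.exp (-((l + k + j : ℝ) : ℂ) * Complex.log (kerBase w v)) := by
      filter_upwards [isOpen_upperHalfPlaneSet.mem_nhds u.im_pos] with v hv
      exact hc w ⟨v, hv⟩
    have h4 := h1.unique (h2.congr_of_eventuallyEq h3)
    rw [integral_const_mul] at h4
    have e : l + k + ((j + 1 : ℕ) : ℝ) = l + k + j + 1 := by
      push_cast
      ring
    have h5 : bergKer (l + k + j + 1) w u =
      Complex.exp (-((l + k + j + 1 : ℝ) : ℂ) * Complex.log (kerBase w u)) := rfl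
    rw [e, h5]
    refine mul_left_cancel₀ (mul_ne_zero Complex.I_ne_zero hlj) ?_
    rw [h4]
    field_simp

/-! ### The image of a kernel -/

/-- The kernel is a power of the affine function `-i (z - conj w)`. Taking that function as
denominator, `h` constant and `g = 1` turns the transformation rule into this evaluation. -/
theorem segIntegral_bergKer {α β : ℝ} (hα : 0 < α) (hβ : 0 < β) (w a b : ℍ) :
    segIntegral α β (bergKer (α + β) w) a b =
      (∫ v in (-1 : ℝ)..1, betaWeight α β v) * (bergKer α w a * bergKer β w b) := by
  have h := segIntegral_comp (α := (α : ℂ)) (β := (β : ℂ)) (by simpa using hα) (by simpa using hβ)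
    (a := -Complex.I * UpperHalfPlane.I) (b := Complex.I * conj (w : ℂ) * UpperHalfPlane.I)
    (c := -Complex.I) (d := Complex.I * conj (w : ℂ))
    (mdifferentiable_log_kerBase w)
    (fun z => by
      rw [Complex.exp_log (kerBase_ne_zero w z), kerBase]
      ring)
    (h := fun _ => UpperHalfPlane.I) mdifferentiable_const (fun z => by ring)
    (g := fun _ => 1) mdifferentiable_const a b
  simp only [mul_one] at h
  have e : segIntegral (α : ℂ) β (fun _ => 1) UpperHalfPlane.I UpperHalfPlane.I =
      ∫ v in (-1 : ℝ)..1, betaWeight α β v := by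
    simp only [segIntegral, one_mul]
  rw [e] at h
  have e2 : bergKer (α + β) w =
      fun z : ℍ => Complex.exp (-((α : ℂ) + β) * Complex.log (kerBase w z)) := by
    ext z
    rw [bergKer]
    push_cast
    rfl
  rw [e2, h, bergKer, bergKer]
  ring

theorem integral_betaWeight_ne_zero {α β : ℝ} (hα : 0 < α) (hβ : 0 < β) :
    ∫ v in (-1 : ℝ)..1, betaWeight α β v ≠ 0 := by
  have hint := intervalIntegrable_betaWeight (α := (α : ℂ)) (β := (β : ℂ)) (by simpa using hα)
    (by simpa using hβ)
  have hre : ∀ v ∈ Ioo (-1 : ℝ) 1, (betaWeight α β v) =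
      (((1 - v) ^ (α - 1) * (1 + v) ^ (β - 1) : ℝ) : ℂ) := by
    intro v hv
    rw [betaWeight, Complex.ofReal_mul, Complex.ofReal_cpow (by linarith [hv.2]),
      Complex.ofReal_cpow (by linarith [hv.1])]
    push_cast
    rfl
  have hpos : 0 < ∫ v in (-1 : ℝ)..1, (betaWeight α β v).re := by
    refine intervalIntegral.intervalIntegral_pos_of_pos_on ⟨hint.1.re, hint.2.re⟩
      (fun v hv => ?_) (by norm_num)
    rw [hre v hv, Complex.ofReal_re]
    have h1 : 0 < 1 - v := by linarith [hv.2]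
    have h2 : 0 < 1 + v := by linarith [hv.1]
    positivity
  have hcomm : ∫ v in (-1 : ℝ)..1, (betaWeight α β v).re =
      (∫ v in (-1 : ℝ)..1, betaWeight α β v).re :=
    Complex.reCLM.intervalIntegral_comp_comm hint
  intro h
  rw [hcomm, h] at hpos
  simp at hpos

theorem sub_eq_kerBase_sub (w a b : ℂ) : a - b = Complex.I * (kerBase w a - kerBase w b) := by
  simp only [kerBase]
  linear_combination (a - b) * Complex.I_mul_I

theorem bergKer_mul_kerBase_pow (s : ℝ) {ℓ m : ℕ} (hm : m ≤ ℓ) (w z : ℍ) :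
    bergKer (s + ℓ) w z * kerBase w z ^ m = bergKer (s + (ℓ - m : ℕ)) w z := by
  rw [bergKer_add, bergKer_add, bergKer_nat, bergKer_nat, mul_assoc]
  congr 1
  have h0 := kerBase_ne_zero w z
  have e : kerBase w z ^ ℓ = kerBase w z ^ m * kerBase w z ^ (ℓ - m) := by
    rw [← pow_add, Nat.add_sub_cancel' hm]
  rw [e]
  field_simp

/-- The image of a kernel under `Ψ`, up to a constant. -/
def pairKer (p q : ℝ) (ℓ : ℕ) (w : ℍ) (z : ℍ × ℍ) : ℂ :=
  ((z.1 : ℂ) - z.2) ^ ℓ * (bergKer (p + ℓ) w z.1 * bergKer (q + ℓ) w z.2)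

theorem continuous_pairKer (p q : ℝ) (ℓ : ℕ) (w : ℍ) : Continuous (pairKer p q ℓ w) := by
  have h1 := (mdifferentiable_bergKer (p + ℓ) w).continuous
  have h2 := (mdifferentiable_bergKer (q + ℓ) w).continuous
  unfold pairKer
  fun_prop

/-- Writing `z₁ - z₂` as `i` times a difference of `kerBase` values, the binomial theorem lowers
kernel exponents and separates the variables. Each term is a product of square integrable kernels.
-/
theorem pairKer_eq_sum (p q : ℝ) (ℓ : ℕ) (w : ℍ) (z : ℍ × ℍ) :
    pairKer p q ℓ w z = ∑ m ∈ Finset.range (ℓ + 1),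
      (Complex.I ^ ℓ * (-1) ^ (ℓ - m) * (ℓ.choose m : ℂ)) *
        (bergKer (p + (ℓ - m : ℕ)) w z.1 * bergKer (q + m) w z.2) := by
  rw [pairKer, sub_eq_kerBase_sub w, mul_pow, sub_eq_add_neg, add_pow, Finset.mul_sum,
    Finset.sum_mul]
  refine Finset.sum_congr rfl fun m hm => ?_
  have hm' : m ≤ ℓ := Nat.lt_succ_iff.1 (Finset.mem_range.1 hm)
  have h2 := bergKer_mul_kerBase_pow q (Nat.sub_le ℓ m) w z.2
  rw [Nat.sub_sub_self hm'] at h2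
  rw [← bergKer_mul_kerBase_pow p hm' w z.1, ← h2, neg_pow]
  ring

theorem memLp_prod_mul {X Y : Type*} [MeasurableSpace X] [MeasurableSpace Y] {μ : Measure X}
    {ν : Measure Y} [SigmaFinite μ] [SigmaFinite ν] {f : X → ℂ} {g : Y → ℂ} (hf : MemLp f 2 μ)
    (hg : MemLp g 2 ν) : MemLp (fun z : X × Y => f z.1 * g z.2) 2 (μ.prod ν) := by
  have hm : AEStronglyMeasurable (fun z : X × Y => f z.1 * g z.2) (μ.prod ν) :=
    hf.1.comp_fst.mul hg.1.comp_snd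
  rw [memLp_two_iff_integrable_sq_norm hm]
  refine (((memLp_two_iff_integrable_sq_norm hf.1).1 hf).mul_prod
    ((memLp_two_iff_integrable_sq_norm hg.1).1 hg)).congr (Eventually.of_forall fun z => ?_)
  simp only [norm_mul, mul_pow]

theorem memLp_pairKer {p q : ℝ} (hp : 1 < p) (hq : 1 < q) (ℓ : ℕ) (w : ℍ) :
    MemLp (pairKer p q ℓ w) 2 ((bergmanMeasure p).prod (bergmanMeasure q)) := by
  have h : pairKer p q ℓ w = fun z => ∑ m ∈ Finset.range (ℓ + 1),
      (Complex.I ^ ℓ * (-1) ^ (ℓ - m) * (ℓ.choose m : ℂ)) *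
        (bergKer (p + (ℓ - m : ℕ)) w z.1 * bergKer (q + m) w z.2) :=
    funext (pairKer_eq_sum p q ℓ w)
  rw [h]
  exact memLp_finsetSum _ fun m _ =>
    (memLp_prod_mul (memLp_bergKer_add hp _ w) (memLp_bergKer_add hq _ w)).const_mul _

/-- After both expansions the `(m, n)` term factors into two one-variable pairings, with exponents
`p + (ℓ - m) + (ℓ - n)` and `q + m + n`. Their sum does not depend on `m` and `n`, so every term is
a multiple of the same kernel. -/
theorem exists_integral_pairKer {p q : ℝ} (hp : 1 < p) (hq : 1 < q) (ℓ : ℕ) :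
    ∃ c : ℂ, ∀ w u : ℍ, ∫ z, pairKer p q ℓ w z * conj (pairKer p q ℓ u z)
      ∂((bergmanMeasure p).prod (bergmanMeasure q)) = c * bergKer (p + q + 2 * ℓ) w u := by
  choose c₁ hc₁ using fun j k => exists_integral_bergKer_mul hp j k
  choose c₂ hc₂ using fun j k => exists_integral_bergKer_mul hq j k
  set e : ℕ → ℂ := fun m => Complex.I ^ ℓ * (-1) ^ (ℓ - m) * (ℓ.choose m : ℂ) with he
  refine ⟨∑ m ∈ Finset.range (ℓ + 1), ∑ n ∈ Finset.range (ℓ + 1),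
    e m * conj (e n) * (c₁ (ℓ - m) (ℓ - n) * c₂ m n), fun w u => ?_⟩
  have hexp : ∀ z, pairKer p q ℓ w z * conj (pairKer p q ℓ u z) =
      ∑ m ∈ Finset.range (ℓ + 1), ∑ n ∈ Finset.range (ℓ + 1), e m * conj (e n) *
        ((bergKer (p + (ℓ - m : ℕ)) w z.1 * bergKer (p + (ℓ - n : ℕ)) z.1 u) *
          (bergKer (q + m) w z.2 * bergKer (q + n) z.2 u)) := by
    intro z
    rw [pairKer_eq_sum, pairKer_eq_sum, map_sum, Finset.sum_mul_sum]
    refine Finset.sum_congr rfl fun m _ => Finset.sum_congr rfl fun n _ => ?_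
    simp only [he, map_mul, conj_bergKer]
    ring
  have hint : ∀ m n : ℕ, Integrable (fun z : ℍ × ℍ => e m * conj (e n) *
        ((bergKer (p + (ℓ - m : ℕ)) w z.1 * bergKer (p + (ℓ - n : ℕ)) z.1 u) *
          (bergKer (q + m) w z.2 * bergKer (q + n) z.2 u)))
      ((bergmanMeasure p).prod (bergmanMeasure q)) := fun m n =>
    ((integrable_bergKer_mul hp _ _ w u).mul_prod (integrable_bergKer_mul hq _ _ w u)).const_mul _
  simp only [hexp]
  rw [integral_finsetSum _ fun m _ => integrable_finsetSum _ fun n _ => hint m n, Finset.sum_mul]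
  refine Finset.sum_congr rfl fun m hm => ?_
  rw [integral_finsetSum _ fun n _ => hint m n, Finset.sum_mul]
  refine Finset.sum_congr rfl fun n hn => ?_
  have hm' : m ≤ ℓ := Nat.lt_succ_iff.1 (Finset.mem_range.1 hm)
  have hn' : n ≤ ℓ := Nat.lt_succ_iff.1 (Finset.mem_range.1 hn)
  rw [integral_const_mul, integral_prod_mul
    (f := fun z => bergKer (p + (ℓ - m : ℕ)) w z * bergKer (p + (ℓ - n : ℕ)) z u)
    (g := fun z => bergKer (q + m) w z * bergKer (q + n) z u), hc₁, hc₂]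
  have hs : p + q + 2 * ℓ = (p + (ℓ - m : ℕ) + (ℓ - n : ℕ)) + (q + m + n) := by
    rw [Nat.cast_sub hm', Nat.cast_sub hn']
    ring
  rw [hs, bergKer_add (p + (ℓ - m : ℕ) + (ℓ - n : ℕ)) (q + m + n)]
  ring

theorem exists_pos_integral_pairKer {p q : ℝ} (hp : 1 < p) (hq : 1 < q) (ℓ : ℕ) :
    ∃ c : ℝ, 0 < c ∧ ∀ w u : ℍ, ∫ z, pairKer p q ℓ w z * conj (pairKer p q ℓ u z)
      ∂((bergmanMeasure p).prod (bergmanMeasure q)) = c * bergKer (p + q + 2 * ℓ) w u := by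
  obtain ⟨c, hc⟩ := exists_integral_pairKer hp hq ℓ
  set w : ℍ := UpperHalfPlane.I
  set μ := (bergmanMeasure p).prod (bergmanMeasure q)
  have hL := memLp_pairKer hp hq ℓ w
  have hint := (memLp_two_iff_integrable_sq_norm hL.1).1 hL
  have hpos : 0 < ∫ z, ‖pairKer p q ℓ w z‖ ^ 2 ∂μ := by
    rw [integral_pos_iff_support_of_nonneg (fun z => by positivity) hint]
    have hcont : Continuous fun z => ‖pairKer p q ℓ w z‖ ^ 2 :=
      ((continuous_pairKer p q ℓ w).norm).pow 2
    -- A point off the diagonal is chosen so that `(z₁ - z₂) ^ ℓ` does not vanish.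
    refine (hcont.isOpen_support).measure_pos μ ⟨(w, (2 : ℝ) +ᵥ w), ?_⟩
    have h2 : (w : ℂ) - (((2 : ℝ) +ᵥ w : ℍ) : ℂ) ≠ 0 := by
      rw [coe_vadd]
      simp
    have : pairKer p q ℓ w (w, (2 : ℝ) +ᵥ w) ≠ 0 :=
      mul_ne_zero (pow_ne_zero _ h2) (mul_ne_zero (bergKer_ne_zero _ _ _) (bergKer_ne_zero _ _ _))
    simpa using this
  have h1 := hc w w
  have h2 : ∀ z, pairKer p q ℓ w z * conj (pairKer p q ℓ w z) =
      ((‖pairKer p q ℓ w z‖ ^ 2 : ℝ) : ℂ) := fun z => by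
    rw [Complex.mul_conj, Complex.normSq_eq_norm_sq]
  simp only [h2, integral_complex_ofReal, bergKer_self] at h1
  have hk : 0 < (2 * w.im) ^ (-(p + q + 2 * (ℓ : ℝ))) :=
    Real.rpow_pos_of_pos (by linarith [w.im_pos]) _
  refine ⟨(∫ z, ‖pairKer p q ℓ w z‖ ^ 2 ∂μ) / (2 * w.im) ^ (-(p + q + 2 * (ℓ : ℝ))),
    div_pos hpos hk, fun v u => ?_⟩
  rw [hc v u, Complex.ofReal_div, h1, mul_div_cancel_right₀ _ (Complex.ofReal_ne_zero.2 hk.ne')]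

/-! ### Density of the kernels -/

theorem HolPi.eq_of_ae_eq {l : ℝ} {f g : HolPi} (h : f.1 =ᵐ[bergmanMeasure l] g.1) : f = g :=
  Subtype.ext (ContinuousMap.ext fun z => congrFun
    ((Continuous.ae_eq_iff_eq (bergmanMeasure l) f.1.continuous g.1.continuous).1 h) z)

/-- The Bergman kernel as a holomorphic function. -/
def kerHol (l : ℝ) (w : ℍ) : HolPi :=
  ⟨⟨bergKer l w, (mdifferentiable_bergKer l w).continuous⟩, mdifferentiable_bergKer l w⟩

/-- The Bergman kernel as a square integrable function. -/
def kerLp {l : ℝ} (hl : 1 < l) (w : ℍ) : Lp ℂ 2 (bergmanMeasure l) := (memLp_bergKer hl w).toLp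

theorem inner_kerLp {l : ℝ} (hl : 1 < l) (w : ℍ) {G : Lp ℂ 2 (bergmanMeasure l)} {g : HolPi}
    (h : G =ᵐ[bergmanMeasure l] g.1) : inner ℂ (kerLp hl w) G = reproConst l * g.1 w := by
  have hae : (fun z => inner ℂ (kerLp hl w z) (G z)) =ᵐ[bergmanMeasure l]
      fun z => g.1 z * conj (bergKer l w z) := by
    filter_upwards [h, (memLp_bergKer hl w).coeFn_toLp] with z h1 h2
    rw [h1, kerLp, h2, RCLike.inner_apply]
  rw [L2.inner_def, integral_congr_ae hae]
  exact integral_mul_conj_bergKer hl g.2 w ((L2.integrable_inner (kerLp hl w) G).congr hae)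

theorem kerLp_ae_eq {l : ℝ} (hl : 1 < l) (w : ℍ) :
    kerLp hl w =ᵐ[bergmanMeasure l] (kerHol l w).1 := (memLp_bergKer hl w).coeFn_toLp

theorem inner_self_eq_ofReal_norm_sq {E : Type*} [NormedAddCommGroup E] [InnerProductSpace ℂ E]
    (x : E) : inner ℂ x x = ((‖x‖ ^ 2 : ℝ) : ℂ) := by
  rw [inner_self_eq_norm_sq_to_K]
  push_cast
  rfl

theorem continuous_norm_kerLp {l : ℝ} (hl : 1 < l) : Continuous fun w => ‖kerLp hl w‖ := by
  have h : (fun w => ‖kerLp hl w‖) = fun w : ℍ => √(reproConst l * (2 * w.im) ^ (-l)) := by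
    ext w
    have h1 := inner_kerLp hl w (kerLp_ae_eq hl w)
    have h2 : (kerHol l w).1 w = (((2 * w.im) ^ (-l) : ℝ) : ℂ) := bergKer_self l w
    rw [h2, inner_self_eq_ofReal_norm_sq] at h1
    have h3 : ‖kerLp hl w‖ ^ 2 = reproConst l * (2 * w.im) ^ (-l) := by exact_mod_cast h1
    rw [← h3, Real.sqrt_sq (norm_nonneg _)]
  rw [h]
  refine Real.continuous_sqrt.comp (continuous_const.mul ?_)
  exact (continuous_const.mul UpperHalfPlane.continuous_im).rpow_const fun w =>
    Or.inl (by have := w.im_pos; simp only [Pi.mul_apply]; positivity)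

theorem linearMap_ae_eq {ι M : Type*} [TopologicalSpace M] [MeasurableSpace M] {μ : Measure M}
    (K : (ι →₀ ℂ) →ₗ[ℂ] Lp ℂ 2 μ) (H : (ι →₀ ℂ) →ₗ[ℂ] C(M, ℂ))
    (h : ∀ i, K (Finsupp.single i 1) =ᵐ[μ] H (Finsupp.single i 1)) (a : ι →₀ ℂ) :
    K a =ᵐ[μ] H a := by
  induction a using Finsupp.induction_linear with
  | zero =>
    rw [map_zero, map_zero]
    exact Lp.coeFn_zero ℂ 2 μ
  | add f g hf hg =>
    rw [map_add, map_add]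
    exact (Lp.coeFn_add _ _).trans (hf.add hg)
  | single i c =>
    have : Finsupp.single i c = c • Finsupp.single i (1 : ℂ) := by simp
    rw [this, map_smul, map_smul]
    exact (Lp.coeFn_smul _ _).trans ((h i).const_smul c)

/-- Finite linear combinations of kernels, as holomorphic functions. -/
def kerHolSum (l : ℝ) : (ℍ →₀ ℂ) →ₗ[ℂ] HolPi := Finsupp.linearCombination ℂ (kerHol l)

/-- Finite linear combinations of kernels, as square integrable functions. -/
def kerLpSum {l : ℝ} (hl : 1 < l) : (ℍ →₀ ℂ) →ₗ[ℂ] Lp ℂ 2 (bergmanMeasure l) :=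
  Finsupp.linearCombination ℂ (kerLp hl)

theorem kerLpSum_ae_eq {l : ℝ} (hl : 1 < l) (a : ℍ →₀ ℂ) :
    kerLpSum hl a =ᵐ[bergmanMeasure l] (kerHolSum l a).1 := by
  refine linearMap_ae_eq (kerLpSum hl) (HolPi.subtype ∘ₗ kerHolSum l) (fun w => ?_) a
  have h1 : kerLpSum hl (Finsupp.single w 1) = kerLp hl w := by simp [kerLpSum]
  have h2 : (HolPi.subtype ∘ₗ kerHolSum l) (Finsupp.single w 1) = (kerHol l w).1 := by
    simp [kerHolSum]
  rw [h1, h2]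
  exact kerLp_ae_eq hl w

theorem exists_seq_tendsto_ae_of_tendsto_Lp {M : Type*} [MeasurableSpace M] {μ : Measure M}
    {f : ℕ → Lp ℂ 2 μ} {g : Lp ℂ 2 μ} (h : Tendsto f atTop (𝓝 g)) :
    ∃ ns : ℕ → ℕ, StrictMono ns ∧
      ∀ᵐ x ∂μ, Tendsto (fun i => f (ns i) x) atTop (𝓝 (g x)) :=
  (tendstoInMeasure_of_tendsto_Lp h).exists_seq_tendsto_ae

theorem ae_eq_of_tendsto_Lp {M : Type*} [MeasurableSpace M] {μ : Measure M}
    {f : ℕ → Lp ℂ 2 μ} {g : Lp ℂ 2 μ} (h : Tendsto f atTop (𝓝 g)) {F : ℕ → M → ℂ} {G : M → ℂ}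
    (hF : ∀ n, f n =ᵐ[μ] F n) (hG : ∀ x, Tendsto (fun n => F n x) atTop (𝓝 (G x))) :
    g =ᵐ[μ] G := by
  obtain ⟨ns, hns, hae⟩ := exists_seq_tendsto_ae_of_tendsto_Lp h
  filter_upwards [hae, ae_all_iff.2 hF] with x h1 h2
  refine tendsto_nhds_unique h1 ?_
  simp only [h2]
  exact (hG x).comp hns.tendsto_atTop

/-- The projection `P` of `G` to the closed span of the kernels has the same pairings with them as
`G`. Approximants of `P` therefore converge pointwise to `g`, while a subsequence converges almost
everywhere to `P`; so `P = G`. Completeness of the Bergman space is not needed. -/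
theorem exists_kerLpSum_tendsto {l : ℝ} (hl : 1 < l) {G : Lp ℂ 2 (bergmanMeasure l)} {g : HolPi}
    (h : G =ᵐ[bergmanMeasure l] g.1) :
    ∃ a : ℕ → (ℍ →₀ ℂ), Tendsto (fun n => kerLpSum hl (a n)) atTop (𝓝 G) := by
  set V := (LinearMap.range (kerLpSum hl)).topologicalClosure with hV
  have : CompleteSpace V := (Submodule.isClosed_topologicalClosure _).completeSpace_coe
  set P := V.starProjection G with hP
  have hPV : P ∈ closure (LinearMap.range (kerLpSum hl) : Set (Lp ℂ 2 (bergmanMeasure l))) :=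
    V.starProjection_apply_mem G
  obtain ⟨x, hx, hxP⟩ := mem_closure_iff_seq_limit.1 hPV
  choose a ha using hx
  have hker : ∀ w, inner ℂ (kerLp hl w) P = reproConst l * g.1 w := by
    intro w
    rw [← inner_kerLp hl w h]
    have hmem : kerLp hl w ∈ V :=
      Submodule.le_topologicalClosure _ ⟨Finsupp.single w 1, by simp [kerLpSum]⟩
    have h0 := (Submodule.mem_orthogonal V _).1 (V.sub_starProjection_mem_orthogonal G) _ hmem
    rw [inner_sub_right, sub_eq_zero] at h0
    exact h0.symm
  have hC : (reproConst l : ℂ) ≠ 0 := Complex.ofReal_ne_zero.2 (reproConst_pos hl).ne'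
  have hPg : P =ᵐ[bergmanMeasure l] g.1 := by
    refine ae_eq_of_tendsto_Lp hxP (F := fun n => (kerHolSum l (a n)).1)
      (fun n => ?_) fun w => ?_
    · rw [← ha n]
      exact kerLpSum_ae_eq hl (a n)
    · have h1 : Tendsto (fun n => inner ℂ (kerLp hl w) (x n)) atTop
          (𝓝 (inner ℂ (kerLp hl w) P)) := tendsto_const_nhds.inner hxP
      rw [hker w] at h1
      have h2 : (fun n => inner ℂ (kerLp hl w) (x n)) =
          fun n => (reproConst l : ℂ) * (kerHolSum l (a n)).1 w := by
        ext n
        rw [← ha n]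
        exact inner_kerLp hl w (kerLpSum_ae_eq hl (a n))
      rw [h2] at h1
      have h3 := h1.const_mul ((reproConst l : ℂ)⁻¹)
      simpa only [inv_mul_cancel_left₀ hC] using h3
  have hPG : P = G := Lp.ext (hPg.trans h.symm)
  refine ⟨a, ?_⟩
  rw [← hPG]
  simpa only [ha] using hxP

/-- By the reproducing property and Cauchy-Schwarz, the error at `u` is at most a constant times
`‖kerLp hl u‖` times the norm error, and `‖kerLp hl u‖` is locally bounded. -/
theorem tendsto_kerHolSum {l : ℝ} (hl : 1 < l) {G : Lp ℂ 2 (bergmanMeasure l)} {g : HolPi}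
    (h : G =ᵐ[bergmanMeasure l] g.1) {a : ℕ → (ℍ →₀ ℂ)}
    (ha : Tendsto (fun n => kerLpSum hl (a n)) atTop (𝓝 G)) :
    Tendsto (fun n => kerHolSum l (a n)) atTop (𝓝 g) := by
  rw [tendsto_subtype_rng, ContinuousMap.tendsto_iff_tendstoLocallyUniformly,
    Metric.tendstoLocallyUniformly_iff]
  intro ε hε w
  have hC := reproConst_pos hl
  have hnear : ∀ᶠ u in 𝓝 w, ‖kerLp hl u‖ < ‖kerLp hl w‖ + 1 :=
    ((continuous_norm_kerLp hl).tendsto w).eventually_lt_const (lt_add_one _)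
  refine ⟨_, hnear, ?_⟩
  have hδ : 0 < reproConst l * ε / (‖kerLp hl w‖ + 1) := by positivity
  filter_upwards [Metric.tendsto_nhds.1 ha _ hδ] with n hn u hu
  have h1 : (reproConst l : ℂ) * (g.1 u - (kerHolSum l (a n)).1 u) =
      inner ℂ (kerLp hl u) (G - kerLpSum hl (a n)) := by
    rw [inner_sub_right, inner_kerLp hl u h, inner_kerLp hl u (kerLpSum_ae_eq hl (a n)), mul_sub]
  have h2 : reproConst l * ‖g.1 u - (kerHolSum l (a n)).1 u‖ ≤
      ‖kerLp hl u‖ * ‖G - kerLpSum hl (a n)‖ := by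
    have h3 := norm_inner_le_norm (𝕜 := ℂ) (kerLp hl u) (G - kerLpSum hl (a n))
    rw [← h1, norm_mul, Complex.norm_real, Real.norm_of_nonneg hC.le] at h3
    exact h3
  rw [dist_comm, dist_eq_norm, lt_div_iff₀ (by positivity)] at hn
  rw [dist_eq_norm]
  have hu' : ‖kerLp hl u‖ < ‖kerLp hl w‖ + 1 := hu
  have h4 : ‖kerLp hl u‖ * ‖G - kerLpSum hl (a n)‖ ≤
      ‖G - kerLpSum hl (a n)‖ * (‖kerLp hl w‖ + 1) := by
    rw [mul_comm]
    gcongr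
  exact lt_of_mul_lt_mul_left (h2.trans_lt (h4.trans_lt hn)) hC.le

theorem inner_linearMap_eq {ι E F : Type*} [NormedAddCommGroup E] [InnerProductSpace ℂ E]
    [NormedAddCommGroup F] [InnerProductSpace ℂ F] (k : ι → E) (k' : ι → F) (c : ℂ)
    (h : ∀ i j, inner ℂ (k' i) (k' j) = c * inner ℂ (k i) (k j)) (a b : ι →₀ ℂ) :
    inner ℂ (Finsupp.linearCombination ℂ k' a) (Finsupp.linearCombination ℂ k' b) =
      c * inner ℂ (Finsupp.linearCombination ℂ k a) (Finsupp.linearCombination ℂ k b) := by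
  induction a using Finsupp.induction_linear with
  | zero => simp
  | add f g hf hg => simp only [map_add, inner_add_left, hf, hg, mul_add]
  | single i s =>
    induction b using Finsupp.induction_linear with
    | zero => simp
    | add f g hf hg => simp only [map_add, inner_add_right, hf, hg, mul_add]
    | single j t =>
      simp only [Finsupp.linearCombination_single, inner_smul_left, inner_smul_right, h]
      ring

/-! ### The isometry -/

theorem psiCLM_kerHol {p q : ℝ} {ℓ : ℕ} (hp : 0 < p + ℓ) (hq : 0 < q + ℓ)
    (h₁ : 0 < ((p : ℂ) + ℓ).re) (h₂ : 0 < ((q : ℂ) + ℓ).re) (w : ℍ) (z : ℍ × ℍ) :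
    (psiCLM h₁ h₂ (kerHol (p + q + 2 * ℓ) w)).1 z =
      psiConst p q ℓ * (∫ v in (-1 : ℝ)..1, betaWeight (p + ℓ : ℝ) (q + ℓ : ℝ) v) *
        pairKer p q ℓ w z := by
  have h := segIntegral_bergKer hp hq w z.1 z.2
  rw [psiCLM_apply, psiIntegral_eq, pairKer]
  have e : (kerHol (p + q + 2 * ℓ) w).1 = bergKer (p + ℓ + (q + ℓ)) w := by
    have : p + ℓ + (q + ℓ) = p + q + 2 * (ℓ : ℝ) := by ring
    rw [this]
    rfl
  rw [e]
  push_cast at h ⊢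
  rw [h]
  ring

/-- Proportional Gram matrices make norms scale by `√ρ` on finite combinations of kernels.
Approximating `G` by such combinations gives a Cauchy sequence of images; its limit agrees with the
image of `g` because the images also converge pointwise. -/
theorem exists_norm_eq {p q : ℝ} (hp : 1 < p) (hq : 1 < q) {ℓ : ℕ}
    (h₁ : 0 < ((p : ℂ) + ℓ).re) (h₂ : 0 < ((q : ℂ) + ℓ).re) :
    ∃ s : ℝ, 0 < s ∧ ∀ (G : Lp ℂ 2 (bergmanMeasure (p + q + 2 * ℓ))) (g : HolPi),
      G =ᵐ[bergmanMeasure (p + q + 2 * ℓ)] g.1 →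
      ∃ H : Lp ℂ 2 ((bergmanMeasure p).prod (bergmanMeasure q)),
        H =ᵐ[(bergmanMeasure p).prod (bergmanMeasure q)] (psiCLM h₁ h₂ g).1 ∧ ‖H‖ = s * ‖G‖ := by
  have hp' : 0 < p + (ℓ : ℝ) := by positivity
  have hq' : 0 < q + (ℓ : ℝ) := by positivity
  have hl : 1 < p + q + 2 * (ℓ : ℝ) := by
    have : (0 : ℝ) ≤ ℓ := Nat.cast_nonneg ℓ
    linarith
  set l : ℝ := p + q + 2 * ℓ with hl_def
  set μ := (bergmanMeasure p).prod (bergmanMeasure q) with hμ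
  set κ : ℂ := psiConst p q ℓ * (∫ v in (-1 : ℝ)..1, betaWeight (p + ℓ : ℝ) (q + ℓ : ℝ) v) with hκ
  have hκ0 : κ ≠ 0 := by
    refine mul_ne_zero (inv_ne_zero (mul_ne_zero ?_ ?_)) (integral_betaWeight_ne_zero hp' hq')
    · simp [Complex.cpow_eq_zero_iff]
    · exact_mod_cast ℓ.factorial_ne_zero
  obtain ⟨c, hc, hcint⟩ := exists_pos_integral_pairKer hp hq ℓ
  have hC := reproConst_pos hl
  have hmem : ∀ w, MemLp (fun z => κ * pairKer p q ℓ w z) 2 μ := fun w =>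
    (memLp_pairKer hp hq ℓ w).const_mul κ
  set k' : ℍ → Lp ℂ 2 μ := fun w => (hmem w).toLp with hk'
  set ρ : ℝ := ‖κ‖ ^ 2 * c / reproConst l with hρ
  have hρ0 : 0 < ρ := by
    have := norm_pos_iff.2 hκ0
    positivity
  have hinner : ∀ w u, inner ℂ (k' w) (k' u) = (ρ : ℂ) * inner ℂ (kerLp hl w) (kerLp hl u) := by
    intro w u
    have hae : (fun z => inner ℂ (k' w z) (k' u z)) =ᵐ[μ]
        fun z => ((‖κ‖ ^ 2 : ℝ) : ℂ) * (pairKer p q ℓ u z * conj (pairKer p q ℓ w z)) := by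
      filter_upwards [(hmem w).coeFn_toLp, (hmem u).coeFn_toLp] with z h3 h4
      simp only [hk']
      rw [h3, h4, RCLike.inner_apply, map_mul, ← Complex.normSq_eq_norm_sq, ← Complex.mul_conj]
      ring
    -- The inner product is conjugate-linear in its first slot, hence the swap of `w` and `u`.
    rw [L2.inner_def, integral_congr_ae hae, integral_const_mul, hcint u w,
      inner_kerLp hl w (kerLp_ae_eq hl u)]
    have e : (kerHol l u).1 w = bergKer l u w := rfl
    have hC' : (reproConst l : ℂ) ≠ 0 := Complex.ofReal_ne_zero.2 hC.ne'
    rw [e, hρ]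
    push_cast
    field_simp
    rw [← hl_def]
  set K' : (ℍ →₀ ℂ) →ₗ[ℂ] Lp ℂ 2 μ := Finsupp.linearCombination ℂ k' with hK'
  have hnorm : ∀ b, ‖K' b‖ = √ρ * ‖kerLpSum hl b‖ := by
    intro b
    have h := inner_linearMap_eq (kerLp hl) k' (ρ : ℂ) hinner b b
    rw [inner_self_eq_ofReal_norm_sq] at h
    erw [inner_self_eq_ofReal_norm_sq] at h
    have h' : ‖K' b‖ ^ 2 = ρ * ‖kerLpSum hl b‖ ^ 2 := by exact_mod_cast h
    rw [← Real.sqrt_sq (norm_nonneg (K' b)), h', Real.sqrt_mul hρ0.le,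
      Real.sqrt_sq (norm_nonneg _)]
  have hae' : ∀ b, K' b =ᵐ[μ] (psiCLM h₁ h₂ (kerHolSum l b)).1 := by
    refine linearMap_ae_eq K'
      (HolPi2.subtype ∘ₗ (psiCLM h₁ h₂ : HolPi →ₗ[ℂ] HolPi2) ∘ₗ kerHolSum l) (fun w => ?_)
    have e1 : K' (Finsupp.single w 1) = k' w := by simp [hK']
    have e2 : (HolPi2.subtype ∘ₗ (psiCLM h₁ h₂ : HolPi →ₗ[ℂ] HolPi2) ∘ₗ kerHolSum l)
        (Finsupp.single w 1) = (psiCLM h₁ h₂ (kerHol l w)).1 := by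
      simp [kerHolSum]
    rw [e1, e2]
    refine (hmem w).coeFn_toLp.trans (Eventually.of_forall fun z => ?_)
    exact (psiCLM_kerHol hp' hq' h₁ h₂ w z).symm
  refine ⟨√ρ, Real.sqrt_pos.2 hρ0, fun G g hGg => ?_⟩
  obtain ⟨a, ha⟩ := exists_kerLpSum_tendsto hl hGg
  have hcau : CauchySeq fun n => K' (a n) := by
    rw [cauchySeq_iff_tendsto_dist_atTop_0]
    have h := (cauchySeq_iff_tendsto_dist_atTop_0.1 ha.cauchySeq).const_mul √ρ
    rw [mul_zero] at h
    refine h.congr fun n => ?_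
    rw [dist_eq_norm, dist_eq_norm, ← map_sub, ← map_sub, hnorm]
  obtain ⟨H, hH⟩ := cauchySeq_tendsto_of_complete hcau
  refine ⟨H, ae_eq_of_tendsto_Lp hH (fun n => hae' (a n)) fun z => ?_, ?_⟩
  · have h := ((psiCLM h₁ h₂).continuous.tendsto g).comp (tendsto_kerHolSum hl hGg ha)
    have h' := (continuous_subtype_val.tendsto _).comp h
    exact ((continuous_eval_const z).tendsto _).comp h'
  · refine tendsto_nhds_unique hH.norm ?_
    simp only [hnorm]
    exact ha.norm.const_mul _

/-- The measure charges nonempty open sets, so a class has only one holomorphic representative.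
Choosing representatives is therefore linear, and dividing by the scaling constant gives an
isometry. -/
theorem exists_isometry {p q : ℝ} (hp : 1 < p) (hq : 1 < q) {ℓ : ℕ}
    (h₁ : 0 < ((p : ℂ) + ℓ).re) (h₂ : 0 < ((q : ℂ) + ℓ).re) :
    ∃ r : ℝ, 0 < r ∧ ∃ T : BergmanPi (p + q + 2 * ℓ) →ₗᵢ[ℂ] BergmanPi2 p q,
      ∀ (F : BergmanPi (p + q + 2 * ℓ)) (g : HolPi),
        F.1 =ᵐ[bergmanMeasure (p + q + 2 * ℓ)] g.1 →
        (T F).1 =ᵐ[(bergmanMeasure p).prod (bergmanMeasure q)]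
          fun ζ => (r : ℂ) * (psiCLM h₁ h₂ g).1 ζ := by
  obtain ⟨s, hs, hex⟩ := exists_norm_eq hp hq h₁ h₂
  choose rep hrep using fun F : BergmanPi (p + q + 2 * ℓ) => F.2
  choose H hH hnorm using fun F : BergmanPi (p + q + 2 * ℓ) => hex F.1 (rep F) (hrep F)
  have hsum : ∀ F G, H (F + G) = H F + H G := by
    intro F G
    have e : rep (F + G) = rep F + rep G := by
      refine HolPi.eq_of_ae_eq (l := p + q + 2 * ℓ) ((hrep (F + G)).symm.trans ?_)
      exact (Lp.coeFn_add F.1 G.1).trans ((hrep F).add (hrep G))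
    refine Lp.ext ((hH (F + G)).trans ?_)
    rw [e, map_add]
    exact ((Lp.coeFn_add _ _).trans ((hH F).add (hH G))).symm
  have hsmul : ∀ (c : ℂ) F, H (c • F) = c • H F := by
    intro c F
    have e : rep (c • F) = c • rep F := by
      refine HolPi.eq_of_ae_eq (l := p + q + 2 * ℓ) ((hrep (c • F)).symm.trans ?_)
      exact (Lp.coeFn_smul c F.1).trans ((hrep F).const_smul c)
    refine Lp.ext ((hH (c • F)).trans ?_)
    rw [e, map_smul]
    exact ((Lp.coeFn_smul _ _).trans ((hH F).const_smul c)).symm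
  have hT : ∀ F, ((s⁻¹ : ℝ) : ℂ) • H F =ᵐ[(bergmanMeasure p).prod (bergmanMeasure q)]
      (((s⁻¹ : ℝ) : ℂ) • psiCLM h₁ h₂ (rep F)).1 := fun F =>
    (Lp.coeFn_smul _ _).trans ((hH F).const_smul _)
  set T₀ : BergmanPi (p + q + 2 * ℓ) → BergmanPi2 p q := fun F => ⟨((s⁻¹ : ℝ) : ℂ) • H F, _, hT F⟩
  have hadd : ∀ F G, T₀ (F + G) = T₀ F + T₀ G := fun F G => Subtype.ext (by
    change ((s⁻¹ : ℝ) : ℂ) • H (F + G) = ((s⁻¹ : ℝ) : ℂ) • H F + ((s⁻¹ : ℝ) : ℂ) • H G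
    rw [hsum, smul_add])
  have hsm : ∀ (c : ℂ) F, T₀ (c • F) = c • T₀ F := fun c F => Subtype.ext (by
    change ((s⁻¹ : ℝ) : ℂ) • H (c • F) = c • ((s⁻¹ : ℝ) : ℂ) • H F
    rw [hsmul, smul_comm])
  have hnormT : ∀ F, ‖T₀ F‖ = ‖F‖ := by
    intro F
    change ‖((s⁻¹ : ℝ) : ℂ) • H F‖ = ‖F.1‖
    rw [norm_smul, hnorm, Complex.norm_real, Real.norm_of_nonneg (inv_pos.2 hs).le,
      inv_mul_cancel_left₀ hs.ne']
  refine ⟨s⁻¹, inv_pos.2 hs, ⟨⟨⟨T₀, hadd⟩, hsm⟩, hnormT⟩, fun F g hg => ?_⟩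
  have e : rep F = g := HolPi.eq_of_ae_eq (l := p + q + 2 * ℓ) ((hrep F).symm.trans hg)
  refine (hT F).trans (Eventually.of_forall fun z => ?_)
  rw [e]
  rfl

end Holographic

end

theorem mainTheorem5 (l₁ l₂ l₃ : ℂ) (ℓ : ℕ) (hℓ : (l₃ - l₁ - l₂) / 2 = (ℓ : ℂ))
    (h₁ : 0 < (l₁ + ℓ).re) (h₂ : 0 < (l₂ + ℓ).re) :
    (∀ (g : Holographic.HolPi) (ζ₁ ζ₂ : UpperHalfPlane),
      IntervalIntegrable (Holographic.psiIntegrand l₁ l₂ ℓ g.1 ζ₁ ζ₂) volume (-1) 1) ∧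
    ∃ Ψ : Holographic.HolPi →L[ℂ] Holographic.HolPi2,
      (∀ (g : Holographic.HolPi) (ζ₁ ζ₂ : UpperHalfPlane),
        (Ψ g).1 (ζ₁, ζ₂) = Holographic.psiIntegral l₁ l₂ ℓ g.1 ζ₁ ζ₂) ∧
      (∀ (a : Holographic.SL2Tilde) (g : Holographic.HolPi),
        Ψ (Holographic.piRep l₃ a g) = Holographic.tensorRep l₁ l₂ a (Ψ g)) ∧
      (l₁.im = 0 → l₂.im = 0 → 1 < l₁.re → 1 < l₂.re →
        ∃ r : ℝ, 0 < r ∧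
          ∃ T : Holographic.BergmanPi l₃.re →ₗᵢ[ℂ] Holographic.BergmanPi2 l₁.re l₂.re,
            ∀ (F : Holographic.BergmanPi l₃.re) (g : Holographic.HolPi),
              F.1 =ᵐ[Holographic.bergmanMeasure l₃.re] g.1 →
              (T F).1 =ᵐ[(Holographic.bergmanMeasure l₁.re).prod
                (Holographic.bergmanMeasure l₂.re)] fun ζ => (r : ℂ) * (Ψ g).1 ζ) := by
  refine ⟨fun g ζ₁ ζ₂ => ?_, Holographic.psiCLM h₁ h₂, fun g ζ₁ ζ₂ => rfl,
    Holographic.psiCLM_piRep hℓ h₁ h₂, fun him₁ him₂ hp hq => ?_⟩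
  · rw [Holographic.psiIntegrand_eq]
    exact Holographic.intervalIntegrable_comp_segPt_mul h₁ h₂ g.1.continuous ζ₁ ζ₂
  · obtain ⟨p, rfl⟩ : ∃ p : ℝ, l₁ = p := ⟨l₁.re, Complex.ext rfl him₁⟩
    obtain ⟨q, rfl⟩ : ∃ q : ℝ, l₂ = q := ⟨l₂.re, Complex.ext rfl him₂⟩
    obtain rfl : l₃ = ((p + q + 2 * ℓ : ℝ) : ℂ) := by
      push_cast
      linear_combination 2 * hℓ
    exact Holographic.exists_isometry hp hq h₁ h₂
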